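/- For a random variable $U$ with variance $\sigma^2$ and continuously differentiable density $f$, let $\rho_U=f'/f$ be its score function, $J(U)=\mathbb E\,\rho_U(U)^2$ its Fisher information and $J_{\rm st}(U)=\sigma^2J(U)-1$ its standardised Fisher information. For random variables $X,Y$ and $\beta\in[0,1]$ put $$\Delta(X,Y,\beta)=\mathbb E\Big(\sqrt\beta\,\rho_X(X)+\sqrt{1-\beta}\,\rho_Y(Y)-\widetilde\rho\big(\sqrt\beta X+\sqrt{1-\beta}\,Y\big)\Big)^2,$$ where $\widetilde\rho$ is the score function of $\sqrt\beta X+\sqrt{1-\beta}\,Y$. For a function $\psi$ let $\mathcal C_\psi$ be the class of random variables $X$ with finite variance $\sigma^2$ such that $\mathbb E\,X^2\,\mathbf 1(|X|\ge R\sigma)\le\sigma^2\psi(R)$ for all $R\ge 0$. Proposition. Let $\tau>0$ and $K$ be fixed. For any function $\psi$ with $\psi(R)\to0$ as $R\to\infty$ there is a function $\nu=\nu_\psi=\nu_{\psi,\tau,K}:\mathbb R\to\mathbb R$ with $\nu(\epsilon)\to0$ as $\epsilon\to0$ and $\nu(0)=0$ such that the following holds. Let $X=S+Z_S$ and $Y=T+Z_T$,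 where $S,T$ are (possibly dependent) random variables with variances at most $K$, and $Z_S,Z_T$ are $N(0,\tau)$ variables, independent of $(S,T)$ and of each other. If $X,Y\in\mathcal C_\psi$, then for every $\beta\in[0,1]$ the variables $X$, $Y$ and $\sqrt\beta X+\sqrt{1-\beta}\,Y$ have continuously differentiable densities, $J(X)$ and $\Delta(X,Y,\beta)$ are finite, and $$\beta(1-\beta)\,J_{\rm st}(X)\le\nu\big(\Delta(X,Y,\beta)\big).$$ -/

import Mathlib

open MeasureTheory ProbabilityTheory Filter Topology
open scoped NNReal ENNReal

noncomputable section

/-- `f` is a nonnegative continuously differentiable Lebesgue density of `μ`. -/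
def IsSmoothDensity (μ : Measure ℝ) (f : ℝ → ℝ) : Prop :=
  ContDiff ℝ 1 f ∧ (∀ x, 0 ≤ f x) ∧ μ = volume.withDensity (fun x => ENNReal.ofReal (f x))

/-- A finite measure has at most one smooth density, so that densities and scores below are
canonical, pointwise defined functions. -/
theorem IsSmoothDensity.unique {μ : Measure ℝ} [IsFiniteMeasure μ] {f g : ℝ → ℝ}
    (hf : IsSmoothDensity μ f) (hg : IsSmoothDensity μ g) : f = g := by
  obtain ⟨hfc, hf0, hfd⟩ := hf
  obtain ⟨hgc, hg0, hgd⟩ := hg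
  have hfm : Measurable (fun x => ENNReal.ofReal (f x)) :=
    hfc.continuous.measurable.ennreal_ofReal
  have hgm : Measurable (fun x => ENNReal.ofReal (g x)) :=
    hgc.continuous.measurable.ennreal_ofReal
  have hfin : ∫⁻ x, ENNReal.ofReal (f x) ≠ ∞ := by
    have h : μ Set.univ ≠ ∞ := measure_ne_top μ _
    rwa [hfd, withDensity_apply _ MeasurableSet.univ, Measure.restrict_univ] at h
  have hae : (fun x => ENNReal.ofReal (f x)) =ᵐ[volume] (fun x => ENNReal.ofReal (g x)) :=
    (withDensity_eq_iff hfm.aemeasurable hgm.aemeasurable hfin).1 (hfd.symm.trans hgd)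
  have hae' : f =ᵐ[volume] g := by
    filter_upwards [hae] with x hx
    exact (ENNReal.ofReal_eq_ofReal_iff (hf0 x) (hg0 x)).1 hx
  exact (Continuous.ae_eq_iff_eq volume hfc.continuous hgc.continuous).1 hae'

open Classical in
/-- The smooth density of `μ` (and `0` if there is none). -/
def smoothDensity (μ : Measure ℝ) : ℝ → ℝ :=
  if h : ∃ f, IsSmoothDensity μ f then h.choose else 0

section RandomVariables

variable {Ω : Type*} [MeasurableSpace Ω]

/-- The random variable `U` has a smooth density. -/
def HasSmoothDensity (U : Ω → ℝ) (P : Measure Ω) : Prop :=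
  ∃ f, IsSmoothDensity (P.map U) f

/-- The score function `ρ = f' / f`, for `f` the smooth density of `U`. -/
def score (U : Ω → ℝ) (P : Measure Ω) (u : ℝ) : ℝ :=
  deriv (smoothDensity (P.map U)) u / smoothDensity (P.map U) u

/-- The Fisher information `J(U) = E ρ(U)²`. -/
def fisherInfo (U : Ω → ℝ) (P : Measure Ω) : ℝ :=
  ∫ ω, score U P (U ω) ^ 2 ∂P

/-- The standardised Fisher information `J_st(U) = σ² J(U) - 1`, with `σ²` the variance of `U`. -/
def stdFisherInfo (U : Ω → ℝ) (P : Measure Ω) : ℝ :=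
  variance U P * fisherInfo U P - 1

/-- The normalised sum `√β X + √(1-β) Y`. -/
def mix (X Y : Ω → ℝ) (β : ℝ) (ω : Ω) : ℝ :=
  √β * X ω + √(1 - β) * Y ω

/-- The defect
`√β ρ_X(X) + √(1-β) ρ_Y(Y) - ρ̃(√β X + √(1-β) Y)`, `ρ̃` the score of `√β X + √(1-β) Y`. -/
def scoreDefect (X Y : Ω → ℝ) (β : ℝ) (P : Measure Ω) (ω : Ω) : ℝ :=
  √β * score X P (X ω) + √(1 - β) * score Y P (Y ω) - score (mix X Y β) P (mix X Y β ω)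

/-- `Δ(X, Y, β)`, the second moment of the score defect. -/
def Delta (X Y : Ω → ℝ) (β : ℝ) (P : Measure Ω) : ℝ :=
  ∫ ω, scoreDefect X Y β P ω ^ 2 ∂P

/-- Membership of `X` in the class `C_ψ`: `X` has finite variance `σ²` and
`E X² 1(|X| ≥ R σ) ≤ σ² ψ(R)` for all `R ≥ 0`. -/
def InTailClass (ψ : ℝ → ℝ) (X : Ω → ℝ) (P : Measure Ω) : Prop :=
  MemLp X 2 P ∧ ∀ R : ℝ, 0 ≤ R →
    ∫ ω in {ω | R * √(variance X P) ≤ |X ω|}, X ω ^ 2 ∂P ≤ variance X P * ψ R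

/-- `Z_S`, `Z_T` are `N(0, τ)`, independent of the pair `(S, T)` and of each other. -/
structure IsGaussianPerturbation (S T ZS ZT : Ω → ℝ) (τ : ℝ≥0) (P : Measure Ω) : Prop where
  law_left : HasLaw ZS (gaussianReal 0 τ) P
  law_right : HasLaw ZT (gaussianReal 0 τ) P
  indep_noise : IndepFun ZS ZT P
  indep : IndepFun (fun ω => (S ω, T ω)) (fun ω => (ZS ω, ZT ω)) P

end RandomVariables

end

/-! The theorem is a compactness-free stability argument for the equation `a ρ_X(x) + b ρ_Y(y) =
ρ̃(a x + b y)`, whose solutions are affine scores, that is, Gaussian laws.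

Adding `N(0, τ)` noise makes everything uniform: with second moments bounded, the density is at
least `c exp(-x²/τ)`, so scores grow at most linearly and are locally Lipschitz with constants
common to the whole class. The joint law of `(X, Y)` charges each small square in a box, even for
dependent `S`, `T`, because the noises are independent of each other and of `(S, T)`. Hence a small
mean square `Δ` forces the defect to be uniformly small on the box (`exists_abs_scoreDefect_le`).

Eliminating `ρ_Y` and `ρ̃` leaves an almost additive function, so `ρ_X` is close to an affine
function on an interval (`exists_affine_approx_of_functional_eq`). Since `E ρ = 0` and `E U ρ = -1`,
`J_st` is at most `σ²` times the squared `L²` distance from the score to any affine function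
(`IsSmoothing.stdFisherInfo_le`); outside the interval this distance is controlled by linear growth
and `ψ`. Elimination costs a factor that blows up as `β` nears `0` or `1`, where the weight `β(1-β)`
and a uniform bound on `J_st` suffice. Finally `ν(t)` is the supremum of the left-hand side over all
configurations with `Δ = t`. -/

/-! ### The Gaussian kernel -/

/-- The derivative of the centred Gaussian density of variance `τ`. -/
noncomputable def gaussianPDFDeriv (τ : ℝ≥0) (z : ℝ) : ℝ :=
  -(z / τ) * gaussianPDFReal 0 τ z

theorem gaussianPDFReal_zero_apply (τ : ℝ≥0) (z : ℝ) :
    gaussianPDFReal 0 τ z = gaussianPDFReal 0 τ 0 * Real.exp (-(z ^ 2 / (2 * τ))) := by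
  simp [gaussianPDFReal, neg_div]

theorem gaussianPDFReal_le_zero_apply (τ : ℝ≥0) (z : ℝ) :
    gaussianPDFReal 0 τ z ≤ gaussianPDFReal 0 τ 0 := by
  rw [gaussianPDFReal_zero_apply τ z]
  refine mul_le_of_le_one_right (gaussianPDFReal_nonneg _ _ _) (Real.exp_le_one_iff.2 ?_)
  have : (0 : ℝ) ≤ z ^ 2 / (2 * τ) := by positivity
  linarith

theorem hasDerivAt_gaussianPDFReal (τ : ℝ≥0) (z : ℝ) :
    HasDerivAt (gaussianPDFReal 0 τ) (gaussianPDFDeriv τ z) z := by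
  have h0 : gaussianPDFReal 0 τ
      = fun z => gaussianPDFReal 0 τ 0 * Real.exp (-(z ^ 2 / (2 * τ))) :=
    funext (gaussianPDFReal_zero_apply τ)
  have h : HasDerivAt (fun z : ℝ => gaussianPDFReal 0 τ 0 * Real.exp (-(z ^ 2 / (2 * τ))))
      (gaussianPDFReal 0 τ 0 * (Real.exp (-(z ^ 2 / (2 * τ))) * (-(2 * z / (2 * τ))))) z := by
    have := (((hasDerivAt_pow 2 z).div_const (2 * (τ : ℝ))).neg.exp).const_mul
      (gaussianPDFReal 0 τ 0)
    simpa using this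
  rw [h0]
  convert h using 1
  rw [gaussianPDFDeriv, gaussianPDFReal_zero_apply τ z, mul_div_mul_left _ _ two_ne_zero]
  ring

theorem hasDerivAt_gaussianPDFDeriv (τ : ℝ≥0) (z : ℝ) :
    HasDerivAt (gaussianPDFDeriv τ) ((z ^ 2 / τ ^ 2 - 1 / τ) * gaussianPDFReal 0 τ z) z := by
  have h := (((hasDerivAt_id z).div_const (τ : ℝ)).neg).mul (hasDerivAt_gaussianPDFReal τ z)
  refine h.congr_deriv ?_
  simp only [gaussianPDFDeriv, Pi.neg_apply, id]
  ring

theorem continuous_gaussianPDFReal_zero (τ : ℝ≥0) : Continuous (gaussianPDFReal 0 τ) :=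
  continuous_iff_continuousAt.2 fun z => (hasDerivAt_gaussianPDFReal τ z).continuousAt

theorem continuous_gaussianPDFDeriv (τ : ℝ≥0) : Continuous (gaussianPDFDeriv τ) :=
  continuous_iff_continuousAt.2 fun z => (hasDerivAt_gaussianPDFDeriv τ z).continuousAt

theorem sq_mul_exp_neg_sq_div_le {v : ℝ} (hv : 0 < v) (z : ℝ) :
    z ^ 2 * Real.exp (-(z ^ 2 / v)) ≤ v := by
  have h := Real.add_one_le_exp (z ^ 2 / v)
  have h' : z ^ 2 / v ≤ Real.exp (z ^ 2 / v) := by linarith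
  rw [Real.exp_neg, ← div_eq_mul_inv, div_le_iff₀ (Real.exp_pos _)]
  rwa [div_le_iff₀ hv, mul_comm] at h'

theorem abs_mul_exp_neg_sq_div_le {v : ℝ} (hv : 0 < v) (z : ℝ) :
    |z| * Real.exp (-(z ^ 2 / v)) ≤ 1 + v := by
  have h1 : |z| ≤ 1 + z ^ 2 := by
    nlinarith [sq_abs z, sq_nonneg (|z| - 1), abs_nonneg z]
  have h2 : Real.exp (-(z ^ 2 / v)) ≤ 1 :=
    Real.exp_le_one_iff.2 (by have : 0 ≤ z ^ 2 / v := by positivity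
                              linarith)
  calc |z| * Real.exp (-(z ^ 2 / v)) ≤ (1 + z ^ 2) * Real.exp (-(z ^ 2 / v)) := by gcongr
    _ = Real.exp (-(z ^ 2 / v)) + z ^ 2 * Real.exp (-(z ^ 2 / v)) := by ring
    _ ≤ 1 + v := add_le_add h2 (sq_mul_exp_neg_sq_div_le hv z)

theorem exists_abs_gaussianPDFDeriv_le {τ : ℝ≥0} (hτ : 0 < τ) :
    ∃ C : ℝ, 0 ≤ C ∧ ∀ z, |gaussianPDFDeriv τ z| ≤ C := by
  have hτ' : (0 : ℝ) < τ := hτ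
  have hg := gaussianPDFReal_nonneg 0 τ 0
  refine ⟨(1 + 2 * τ) / τ * gaussianPDFReal 0 τ 0, by positivity, fun z => ?_⟩
  rw [gaussianPDFDeriv, gaussianPDFReal_zero_apply τ z, abs_mul, abs_neg, abs_div,
    abs_of_pos hτ', abs_mul, abs_of_nonneg hg, abs_of_pos (Real.exp_pos _)]
  calc |z| / τ * (gaussianPDFReal 0 τ 0 * Real.exp (-(z ^ 2 / (2 * τ))))
      = (|z| * Real.exp (-(z ^ 2 / (2 * τ)))) / τ * gaussianPDFReal 0 τ 0 := by ring
    _ ≤ _ := by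
      gcongr
      exact abs_mul_exp_neg_sq_div_le (by positivity) z

theorem exists_abs_gaussianPDFDeriv_sub_le {τ : ℝ≥0} (hτ : 0 < τ) :
    ∃ C : ℝ, 0 ≤ C ∧
      ∀ z w, |gaussianPDFDeriv τ z - gaussianPDFDeriv τ w| ≤ C * |z - w| := by
  have hτ' : (0 : ℝ) < τ := hτ
  have hg := gaussianPDFReal_nonneg 0 τ 0
  refine ⟨(2 * τ / τ ^ 2 + 1 / τ) * gaussianPDFReal 0 τ 0, by positivity, fun z w => ?_⟩
  refine Convex.norm_image_sub_le_of_norm_hasDerivWithin_le (s := Set.univ)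
    (fun x _ => (hasDerivAt_gaussianPDFDeriv τ x).hasDerivWithinAt) (fun x _ => ?_)
    convex_univ (Set.mem_univ w) (Set.mem_univ z)
  rw [gaussianPDFReal_zero_apply τ x, Real.norm_eq_abs]
  have h1 := sq_mul_exp_neg_sq_div_le (v := 2 * τ) (by positivity) x
  have h2 : Real.exp (-(x ^ 2 / (2 * τ))) ≤ 1 :=
    Real.exp_le_one_iff.2 (by have : 0 ≤ x ^ 2 / (2 * τ) := by positivity
                              linarith)
  calc |(x ^ 2 / τ ^ 2 - 1 / τ) * (gaussianPDFReal 0 τ 0 * Real.exp (-(x ^ 2 / (2 * τ))))|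
      = |x ^ 2 / (τ : ℝ) ^ 2 - 1 / τ| *
          (gaussianPDFReal 0 τ 0 * Real.exp (-(x ^ 2 / (2 * τ)))) := by
        rw [abs_mul, abs_of_nonneg (by positivity :
          0 ≤ gaussianPDFReal 0 τ 0 * Real.exp (-(x ^ 2 / (2 * τ))))]
    _ ≤ (x ^ 2 / (τ : ℝ) ^ 2 + 1 / τ) *
          (gaussianPDFReal 0 τ 0 * Real.exp (-(x ^ 2 / (2 * τ)))) := by
        gcongr
        refine (abs_sub _ _).trans (le_of_eq ?_)
        rw [abs_of_nonneg (by positivity), abs_of_nonneg (by positivity)]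
    _ = (x ^ 2 * Real.exp (-(x ^ 2 / (2 * τ))) / τ ^ 2
          + 1 / τ * Real.exp (-(x ^ 2 / (2 * τ)))) * gaussianPDFReal 0 τ 0 := by ring
    _ ≤ (2 * τ / τ ^ 2 + 1 / τ * 1) * gaussianPDFReal 0 τ 0 := by gcongr
    _ = _ := by ring

/-- From `(x - s)² ≤ 2x² + 2s²`. The factors in `x` and `s` separate, so one may average over `s`
with no loss in `x`. -/
theorem gaussianPDFReal_sub_ge {τ : ℝ≥0} (hτ : 0 < τ) (x s : ℝ) :
    gaussianPDFReal 0 τ 0 * Real.exp (-(x ^ 2 / τ)) * Real.exp (-(s ^ 2 / τ))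
      ≤ gaussianPDFReal 0 τ (x - s) := by
  have hτ' : (0 : ℝ) < τ := hτ
  rw [gaussianPDFReal_zero_apply τ (x - s), mul_assoc, ← Real.exp_add]
  refine mul_le_mul_of_nonneg_left (Real.exp_le_exp.2 ?_) (gaussianPDFReal_nonneg _ _ _)
  rw [← neg_add, neg_le_neg_iff, ← add_div, div_le_div_iff₀ (by positivity) hτ']
  nlinarith [mul_nonneg hτ'.le (sq_nonneg (x + s))]

/-- Pointwise comparison behind the linear growth of the score. -/
theorem exists_abs_gaussianPDFDeriv_le_add {τ : ℝ≥0} (hτ : 0 < τ) :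
    ∃ D : ℝ, 0 ≤ D ∧ ∀ x z, |gaussianPDFDeriv τ z|
      ≤ 2 * |x| / τ * gaussianPDFReal 0 τ z + D * Real.exp (-(x ^ 2 / τ)) := by
  have hτ' : (0 : ℝ) < τ := hτ
  have hg := gaussianPDFReal_nonneg 0 τ 0
  refine ⟨(1 + 4 * τ) / τ * gaussianPDFReal 0 τ 0, by positivity, fun x z => ?_⟩
  have hz := gaussianPDFReal_nonneg 0 τ z
  have habs : |gaussianPDFDeriv τ z| = |z| / τ * gaussianPDFReal 0 τ z := by
    rw [gaussianPDFDeriv, abs_mul, abs_neg, abs_div, abs_of_pos hτ', abs_of_nonneg hz]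
  rw [habs]
  -- For `|z| ≥ 2|x|`, half of the Gaussian exponent absorbs the factor `|z|` and the other half is
  -- at most `exp(-x²/τ)`.
  rcases le_total |z| (2 * |x|) with h | h
  · refine le_add_of_le_of_nonneg ?_ (by positivity)
    gcongr
  · refine le_add_of_nonneg_of_le (by positivity) ?_
    rw [gaussianPDFReal_zero_apply τ z]
    have hsplit : Real.exp (-(z ^ 2 / (2 * τ)))
        = Real.exp (-(z ^ 2 / (4 * τ))) * Real.exp (-(z ^ 2 / (4 * τ))) := by
      rw [← Real.exp_add]
      congr 1
      field_simp
      ring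
    have hle : Real.exp (-(z ^ 2 / (4 * τ))) ≤ Real.exp (-(x ^ 2 / τ)) := by
      rw [Real.exp_le_exp, neg_le_neg_iff, div_le_div_iff₀ hτ' (by positivity)]
      have : 4 * x ^ 2 ≤ z ^ 2 := by
        rw [← sq_abs x, ← sq_abs z]
        nlinarith [abs_nonneg x, abs_nonneg z]
      nlinarith
    have h1 := abs_mul_exp_neg_sq_div_le (v := 4 * τ) (by positivity) z
    calc |z| / τ * (gaussianPDFReal 0 τ 0 * Real.exp (-(z ^ 2 / (2 * τ))))
        = (|z| * Real.exp (-(z ^ 2 / (4 * τ)))) / τ * gaussianPDFReal 0 τ 0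
            * Real.exp (-(z ^ 2 / (4 * τ))) := by rw [hsplit]; ring
      _ ≤ _ := by gcongr

/-! ### Gaussian smoothing of a probability measure -/

/-- The density of the convolution of `μ` with `N(0, τ)`. -/
noncomputable def smoothed (τ : ℝ≥0) (μ : Measure ℝ) (x : ℝ) : ℝ :=
  ∫ s, gaussianPDFReal 0 τ (x - s) ∂μ

/-- The derivative of `smoothed τ μ`. -/
noncomputable def smoothedDeriv (τ : ℝ≥0) (μ : Measure ℝ) (x : ℝ) : ℝ :=
  ∫ s, gaussianPDFDeriv τ (x - s) ∂μ

theorem smoothed_nonneg (τ : ℝ≥0) (μ : Measure ℝ) (x : ℝ) : 0 ≤ smoothed τ μ x :=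
  integral_nonneg fun _ => gaussianPDFReal_nonneg _ _ _

section Smoothed

variable {τ : ℝ≥0} {μ : Measure ℝ} [IsProbabilityMeasure μ]

theorem integrable_gaussianPDFReal_sub (x : ℝ) :
    Integrable (fun s => gaussianPDFReal 0 τ (x - s)) μ := by
  refine Integrable.of_bound (C := gaussianPDFReal 0 τ 0)
    ((continuous_gaussianPDFReal_zero τ).comp (by fun_prop)).aestronglyMeasurable
    (Eventually.of_forall fun s => ?_)
  rw [Real.norm_of_nonneg (gaussianPDFReal_nonneg _ _ _)]
  exact gaussianPDFReal_le_zero_apply τ _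

theorem integrable_gaussianPDFDeriv_sub (hτ : 0 < τ) (x : ℝ) :
    Integrable (fun s => gaussianPDFDeriv τ (x - s)) μ := by
  obtain ⟨C, -, hC⟩ := exists_abs_gaussianPDFDeriv_le hτ
  exact Integrable.of_bound (C := C)
    ((continuous_gaussianPDFDeriv τ).comp (by fun_prop)).aestronglyMeasurable
    (Eventually.of_forall fun s => hC _)

theorem hasDerivAt_smoothed (hτ : 0 < τ) (x : ℝ) :
    HasDerivAt (smoothed τ μ) (smoothedDeriv τ μ x) x := by
  obtain ⟨C, -, hC⟩ := exists_abs_gaussianPDFDeriv_le hτ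
  refine (hasDerivAt_integral_of_dominated_loc_of_deriv_le (s := Set.univ) (bound := fun _ => C)
    (F := fun x s => gaussianPDFReal 0 τ (x - s)) (F' := fun x s => gaussianPDFDeriv τ (x - s))
    univ_mem (Eventually.of_forall fun y => (integrable_gaussianPDFReal_sub y).1)
    (integrable_gaussianPDFReal_sub x) (integrable_gaussianPDFDeriv_sub hτ x).1
    (Eventually.of_forall fun s y _ => hC _) (integrable_const C)
    (Eventually.of_forall fun s y _ => ?_)).2
  exact (hasDerivAt_gaussianPDFReal τ (y - s)).comp_sub_const y s

theorem exists_abs_smoothedDeriv_le (hτ : 0 < τ) :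
    ∃ C : ℝ, 0 ≤ C ∧ ∀ (μ : Measure ℝ) [IsProbabilityMeasure μ] (x : ℝ),
      |smoothedDeriv τ μ x| ≤ C := by
  obtain ⟨C, hC0, hC⟩ := exists_abs_gaussianPDFDeriv_le hτ
  refine ⟨C, hC0, fun μ _ x => ?_⟩
  have := norm_integral_le_of_norm_le_const (μ := μ) (f := fun s => gaussianPDFDeriv τ (x - s))
    (C := C) (Eventually.of_forall fun s => hC _)
  simpa [smoothedDeriv] using this

theorem exists_abs_smoothedDeriv_sub_le (hτ : 0 < τ) :
    ∃ C : ℝ, 0 ≤ C ∧ ∀ (μ : Measure ℝ) [IsProbabilityMeasure μ] (x y : ℝ),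
      |smoothedDeriv τ μ x - smoothedDeriv τ μ y| ≤ C * |x - y| := by
  obtain ⟨C, hC0, hC⟩ := exists_abs_gaussianPDFDeriv_sub_le hτ
  refine ⟨C, hC0, fun μ _ x y => ?_⟩
  rw [smoothedDeriv, smoothedDeriv, ← integral_sub (integrable_gaussianPDFDeriv_sub hτ x)
    (integrable_gaussianPDFDeriv_sub hτ y)]
  have := norm_integral_le_of_norm_le_const (μ := μ)
    (f := fun s => gaussianPDFDeriv τ (x - s) - gaussianPDFDeriv τ (y - s))
    (C := C * |x - y|) (Eventually.of_forall fun s => by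
      have := hC (x - s) (y - s)
      rwa [sub_sub_sub_cancel_right] at this)
  simpa using this

theorem continuous_smoothedDeriv (hτ : 0 < τ) : Continuous (smoothedDeriv τ μ) := by
  obtain ⟨C, hC0, hC⟩ := exists_abs_smoothedDeriv_sub_le hτ
  exact (LipschitzWith.of_dist_le_mul (K := C.toNNReal) fun x y => by
    simpa [Real.dist_eq, hC0] using hC μ x y).continuous

theorem contDiff_smoothed (hτ : 0 < τ) : ContDiff ℝ 1 (smoothed τ μ) := by
  rw [contDiff_one_iff_deriv]
  refine ⟨fun x => (hasDerivAt_smoothed hτ x).differentiableAt, ?_⟩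
  have : deriv (smoothed τ μ) = smoothedDeriv τ μ :=
    funext fun x => (hasDerivAt_smoothed hτ x).deriv
  rw [this]
  exact continuous_smoothedDeriv hτ

theorem exists_le_smoothed (hτ : 0 < τ) (K : ℝ) :
    ∃ c : ℝ, 0 < c ∧ ∀ (μ : Measure ℝ) [IsProbabilityMeasure μ],
      Integrable (fun s => s ^ 2) μ → ∫ s, s ^ 2 ∂μ ≤ K →
      ∀ x, c * Real.exp (-(x ^ 2 / τ)) ≤ smoothed τ μ x := by
  have hτ' : (0 : ℝ) < τ := hτ
  have hg := gaussianPDFReal_pos 0 τ 0 hτ.ne'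
  refine ⟨gaussianPDFReal 0 τ 0 * Real.exp (-(K / τ)), by positivity, fun μ _ hi hK x => ?_⟩
  -- The tangent to `exp` at `-K/τ`, evaluated at `-s²/τ`; its mean is at least `exp(-K/τ)` as soon
  -- as the second moment is at most `K`.
  have htangent : ∀ s : ℝ, gaussianPDFReal 0 τ 0 * Real.exp (-(x ^ 2 / τ)) *
      (Real.exp (-(K / τ)) * (1 + K / τ - s ^ 2 / τ)) ≤ gaussianPDFReal 0 τ (x - s) := fun s => by
    refine le_trans ?_ (gaussianPDFReal_sub_ge hτ x s)
    refine mul_le_mul_of_nonneg_left ?_ (by positivity)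
    have h := Real.add_one_le_exp (K / τ - s ^ 2 / τ)
    calc Real.exp (-(K / τ)) * (1 + K / τ - s ^ 2 / τ)
        ≤ Real.exp (-(K / τ)) * Real.exp (K / τ - s ^ 2 / τ) := by
          gcongr
          linarith
      _ = Real.exp (-(s ^ 2 / τ)) := by rw [← Real.exp_add]; congr 1; ring
  have hint : Integrable (fun s : ℝ => gaussianPDFReal 0 τ 0 * Real.exp (-(x ^ 2 / τ)) *
      (Real.exp (-(K / τ)) * (1 + K / τ - s ^ 2 / τ))) μ :=
    (((integrable_const _).sub (hi.div_const _)).const_mul _).const_mul _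
  refine le_trans ?_ (integral_mono hint (integrable_gaussianPDFReal_sub x) htangent)
  rw [integral_const_mul, integral_const_mul, integral_sub (integrable_const _) (hi.div_const _),
    integral_div, integral_const]
  have hKτ : (∫ s, s ^ 2 ∂μ) / τ ≤ K / τ := by gcongr
  have : 1 ≤ 1 + K / τ - (∫ s, s ^ 2 ∂μ) / τ := by linarith
  calc gaussianPDFReal 0 τ 0 * Real.exp (-(K / τ)) * Real.exp (-(x ^ 2 / τ))
      = gaussianPDFReal 0 τ 0 * Real.exp (-(x ^ 2 / τ)) * (Real.exp (-(K / τ)) * 1) := by ring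
    _ ≤ gaussianPDFReal 0 τ 0 * Real.exp (-(x ^ 2 / τ)) *
        (Real.exp (-(K / τ)) * (1 + K / τ - (∫ s, s ^ 2 ∂μ) / τ)) := by gcongr
    _ = _ := by simp

theorem smoothed_pos (hτ : 0 < τ) (hi : Integrable (fun s => s ^ 2) μ) (x : ℝ) :
    0 < smoothed τ μ x := by
  obtain ⟨c, hc, h⟩ := exists_le_smoothed hτ (∫ s, s ^ 2 ∂μ)
  exact lt_of_lt_of_le (by positivity) (h μ hi le_rfl x)

/-- Scores of Gaussian smoothings grow at most linearly, uniformly over bounded second moments. -/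
theorem exists_abs_smoothedDeriv_div_le (hτ : 0 < τ) (K : ℝ) :
    ∃ C : ℝ, 0 < C ∧ ∀ (μ : Measure ℝ) [IsProbabilityMeasure μ],
      Integrable (fun s => s ^ 2) μ → ∫ s, s ^ 2 ∂μ ≤ K →
      ∀ x, |smoothedDeriv τ μ x / smoothed τ μ x| ≤ C * (1 + |x|) := by
  have hτ' : (0 : ℝ) < τ := hτ
  obtain ⟨c, hc, hlow⟩ := exists_le_smoothed hτ K
  obtain ⟨D, hD, hup⟩ := exists_abs_gaussianPDFDeriv_le_add hτ
  refine ⟨2 / τ + D / c, by positivity, fun μ _ hi hK x => ?_⟩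
  have hp := smoothed_pos hτ hi x
  have h1 : |smoothedDeriv τ μ x|
      ≤ 2 * |x| / τ * smoothed τ μ x + D * Real.exp (-(x ^ 2 / τ)) := by
    have hint : Integrable (fun s : ℝ => 2 * |x| / τ * gaussianPDFReal 0 τ (x - s)
        + D * Real.exp (-(x ^ 2 / τ))) μ :=
      ((integrable_gaussianPDFReal_sub x).const_mul _).add (integrable_const _)
    refine (norm_integral_le_of_norm_le (f := fun s => gaussianPDFDeriv τ (x - s)) hint
      (Eventually.of_forall fun s => hup x _)).trans
      (le_of_eq ?_)
    rw [integral_add ((integrable_gaussianPDFReal_sub x).const_mul _) (integrable_const _),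
      integral_const_mul, integral_const]
    simp [smoothed]
  -- The remainder decays exactly like the lower bound for the density, so its quotient by the
  -- density is bounded.
  have h2 : D * Real.exp (-(x ^ 2 / τ)) ≤ D / c * smoothed τ μ x := by
    rw [div_mul_eq_mul_div, le_div_iff₀ hc]
    nlinarith [mul_le_mul_of_nonneg_left (hlow μ hi hK x) hD]
  rw [abs_div, abs_of_pos hp, div_le_iff₀ hp]
  have h3 : 2 * |x| / τ + D / c ≤ (2 / τ + D / c) * (1 + |x|) := by
    have : 0 ≤ 2 / (τ : ℝ) + D / c * |x| := by positivity
    calc 2 * |x| / τ + D / c ≤ 2 * |x| / τ + D / c + (2 / (τ : ℝ) + D / c * |x|) := by linarith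
      _ = _ := by ring
  calc |smoothedDeriv τ μ x| ≤ (2 * |x| / τ + D / c) * smoothed τ μ x := by linarith
    _ ≤ _ := by gcongr

/-- Scores of Gaussian smoothings are locally Lipschitz, uniformly over bounded second moments. -/
theorem exists_abs_smoothedDeriv_div_sub_le (hτ : 0 < τ) (K R : ℝ) :
    ∃ L : ℝ, 0 < L ∧ ∀ (μ : Measure ℝ) [IsProbabilityMeasure μ],
      Integrable (fun s => s ^ 2) μ → ∫ s, s ^ 2 ∂μ ≤ K →
      ∀ x y, |x| ≤ R → |y| ≤ R →
        |smoothedDeriv τ μ x / smoothed τ μ x - smoothedDeriv τ μ y / smoothed τ μ y|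
          ≤ L * |x - y| := by
  have hτ' : (0 : ℝ) < τ := hτ
  obtain ⟨c, hc, hlow⟩ := exists_le_smoothed hτ K
  obtain ⟨C, hC, hgrow⟩ := exists_abs_smoothedDeriv_div_le hτ K
  obtain ⟨C₁, hC₁, h₁⟩ := exists_abs_smoothedDeriv_le hτ
  obtain ⟨C₂, hC₂, h₂⟩ := exists_abs_smoothedDeriv_sub_le hτ
  set m := c * Real.exp (-(R ^ 2 / τ)) with hm
  have hm0 : 0 < m := by positivity
  refine ⟨(C₂ + C * (1 + |R|) * C₁ + 1) / m, by positivity, fun μ _ hi hK x y hx hy => ?_⟩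
  have hpx := smoothed_pos hτ hi x
  have hpy := smoothed_pos hτ hi y
  have hmx : m ≤ smoothed τ μ x := by
    refine le_trans ?_ (hlow μ hi hK x)
    rw [hm]
    gcongr c * Real.exp (-(?_ / τ))
    exact sq_le_sq.2 (hx.trans (le_abs_self R))
  have hlip : |smoothed τ μ x - smoothed τ μ y| ≤ C₁ * |x - y| :=
    Convex.norm_image_sub_le_of_norm_hasDerivWithin_le (s := Set.univ)
      (fun x _ => (hasDerivAt_smoothed hτ x).hasDerivWithinAt) (fun x _ => h₁ μ x)
      convex_univ (Set.mem_univ y) (Set.mem_univ x)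
  have hgy : |smoothedDeriv τ μ y / smoothed τ μ y| ≤ C * (1 + |R|) := by
    refine (hgrow μ hi hK y).trans ?_
    exact mul_le_mul_of_nonneg_left (by linarith [le_abs_self R]) hC.le
  -- In this form only the density at `x` is left to bound below; the score at `y` is controlled by
  -- linear growth.
  have hid : smoothedDeriv τ μ x / smoothed τ μ x - smoothedDeriv τ μ y / smoothed τ μ y
      = ((smoothedDeriv τ μ x - smoothedDeriv τ μ y)
        - smoothedDeriv τ μ y / smoothed τ μ y * (smoothed τ μ x - smoothed τ μ y))
          / smoothed τ μ x := by
    field_simp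
    ring
  rw [hid, abs_div, abs_of_pos hpx, div_mul_eq_mul_div (C₂ + C * (1 + |R|) * C₁ + 1)]
  refine div_le_div₀ (by positivity) ?_ hm0 hmx
  calc _ ≤ |smoothedDeriv τ μ x - smoothedDeriv τ μ y|
        + |smoothedDeriv τ μ y / smoothed τ μ y * (smoothed τ μ x - smoothed τ μ y)| := abs_sub _ _
    _ ≤ C₂ * |x - y| + C * (1 + |R|) * (C₁ * |x - y|) := by
      rw [abs_mul]
      gcongr
      exact h₂ μ x y
    _ ≤ _ := by nlinarith [abs_nonneg (x - y)]

end Smoothed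

theorem conv_gaussianReal_eq_withDensity {τ : ℝ≥0} (hτ : 0 < τ) (μ : Measure ℝ)
    [IsProbabilityMeasure μ] :
    μ.conv (gaussianReal 0 τ)
      = volume.withDensity (fun x => ENNReal.ofReal (smoothed τ μ x)) := by
  have hm : Measurable (fun q : ℝ × ℝ => ENNReal.ofReal (gaussianPDFReal 0 τ (q.2 - q.1))) := by
    have := (measurable_gaussianPDFReal 0 τ)
    fun_prop
  ext B hB
  rw [withDensity_apply _ hB, ← lintegral_indicator_one hB,
    Measure.lintegral_conv (by measurability)]
  have hinner : ∀ s : ℝ, ∫⁻ z, B.indicator 1 (s + z) ∂gaussianReal 0 τ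
      = ∫⁻ x in B, ENNReal.ofReal (gaussianPDFReal 0 τ (x - s)) := fun s => by
    have h1 : ∫⁻ z, B.indicator (1 : ℝ → ℝ≥0∞) (s + z) ∂gaussianReal 0 τ
        = ∫⁻ x, B.indicator 1 x ∂((gaussianReal 0 τ).map (s + ·)) := by
      rw [lintegral_map (measurable_one.indicator hB) (by fun_prop)]
    rw [h1, gaussianReal_map_const_add, lintegral_indicator_one hB,
      gaussianReal_apply _ hτ.ne']
    simp [gaussianPDF, gaussianPDFReal]
  simp_rw [hinner]
  rw [lintegral_lintegral_swap (by exact hm.aemeasurable)]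
  refine lintegral_congr fun x => ?_
  rw [smoothed, ofReal_integral_eq_lintegral_ofReal (integrable_gaussianPDFReal_sub x)
    (Eventually.of_forall fun s => gaussianPDFReal_nonneg _ _ _)]

/-! ### Scores of smoothed random variables and their moment identities -/

section Smoothing

variable {Ω : Type*} [MeasurableSpace Ω] {P : Measure Ω}
  {U A Z : Ω → ℝ} {τ : ℝ≥0}

/-- `U` is square integrable and is distributed as the sum of the square integrable variable `A`
and an independent `N(0, τ)` variable. -/
structure IsSmoothing (U A : Ω → ℝ) (τ : ℝ≥0) (P : Measure Ω) : Prop where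
  pos : 0 < τ
  memLp_left : MemLp A 2 P
  memLp : MemLp U 2 P
  map_eq : P.map U = (P.map A).conv (gaussianReal 0 τ)

theorem HasLaw.memLp_two_gaussianReal (hZ : HasLaw Z (gaussianReal 0 τ) P) : MemLp Z 2 P := by
  have h := memLp_id_gaussianReal (μ := 0) (v := τ) 2
  rw [← hZ.map_eq] at h
  exact (memLp_map_measure_iff (by fun_prop) hZ.aemeasurable).1 h

theorem IsSmoothing.integrable_sq_map (h : IsSmoothing U A τ P) :
    Integrable (fun s => s ^ 2) (P.map A) :=
  (integrable_map_measure (by fun_prop) h.memLp_left.aestronglyMeasurable.aemeasurable).2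
    h.memLp_left.integrable_sq

theorem IsSmoothing.integral_sq_map (h : IsSmoothing U A τ P) :
    ∫ s, s ^ 2 ∂(P.map A) = ∫ ω, A ω ^ 2 ∂P :=
  integral_map h.memLp_left.aestronglyMeasurable.aemeasurable (by fun_prop)

variable [IsProbabilityMeasure P]

theorem isSmoothing_add (hτ : 0 < τ) (hA : MemLp A 2 P) (hZ : HasLaw Z (gaussianReal 0 τ) P)
    (hind : IndepFun A Z P) : IsSmoothing (fun ω => A ω + Z ω) A τ P where
  pos := hτ
  memLp_left := hA
  memLp := hA.add (HasLaw.memLp_two_gaussianReal hZ)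
  map_eq := by
    rw [← hZ.map_eq]
    exact hind.map_add_eq_map_conv_map₀ hA.aestronglyMeasurable.aemeasurable hZ.aemeasurable

namespace IsSmoothing

theorem isProbabilityMeasure_map (h : IsSmoothing U A τ P) : IsProbabilityMeasure (P.map A) :=
  Measure.isProbabilityMeasure_map h.memLp_left.aestronglyMeasurable.aemeasurable

theorem isSmoothDensity (h : IsSmoothing U A τ P) :
    IsSmoothDensity (P.map U) (smoothed τ (P.map A)) := by
  have := h.isProbabilityMeasure_map
  refine ⟨contDiff_smoothed h.pos, smoothed_nonneg _ _, ?_⟩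
  rw [h.map_eq, conv_gaussianReal_eq_withDensity h.pos]

theorem hasSmoothDensity (h : IsSmoothing U A τ P) : HasSmoothDensity U P :=
  ⟨_, h.isSmoothDensity⟩

theorem score_eq (h : IsSmoothing U A τ P) (x : ℝ) :
    score U P x = smoothedDeriv τ (P.map A) x / smoothed τ (P.map A) x := by
  have := h.isProbabilityMeasure_map
  have := Measure.isProbabilityMeasure_map (μ := P) h.memLp.aestronglyMeasurable.aemeasurable
  have hd : smoothDensity (P.map U) = smoothed τ (P.map A) := by
    have hex : ∃ f, IsSmoothDensity (P.map U) f := ⟨_, h.isSmoothDensity⟩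
    rw [smoothDensity, dif_pos hex]
    exact hex.choose_spec.unique h.isSmoothDensity
  rw [score, hd, (hasDerivAt_smoothed h.pos x).deriv]

theorem continuous_score (h : IsSmoothing U A τ P) : Continuous (score U P) := by
  have := h.isProbabilityMeasure_map
  rw [funext h.score_eq]
  exact (continuous_smoothedDeriv h.pos).div (contDiff_smoothed h.pos).continuous
    fun x => (smoothed_pos h.pos h.integrable_sq_map x).ne'

theorem memLp_score (h : IsSmoothing U A τ P) : MemLp (fun ω => score U P (U ω)) 2 P := by
  have := h.isProbabilityMeasure_map
  obtain ⟨C, hC, hb⟩ := exists_abs_smoothedDeriv_div_le h.pos (∫ s, s ^ 2 ∂(P.map A))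
  have hdom : MemLp (fun ω => C * (1 + |U ω|)) 2 P :=
    ((memLp_const (1 : ℝ)).add h.memLp.abs).const_mul C
  have hmeas : AEStronglyMeasurable (fun ω => score U P (U ω)) P :=
    (h.continuous_score.comp_aestronglyMeasurable h.memLp.aestronglyMeasurable)
  refine hdom.mono hmeas (Eventually.of_forall fun ω => ?_)
  rw [h.score_eq, Real.norm_eq_abs, Real.norm_eq_abs]
  exact (hb _ h.integrable_sq_map le_rfl _).trans (le_abs_self _)

theorem integrable_comp_iff (h : IsSmoothing U A τ P) {g : ℝ → ℝ} (hg : Continuous g) :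
    Integrable (fun ω => g (U ω)) P ↔ Integrable (fun x => smoothed τ (P.map A) x * g x) := by
  have hm := h.memLp.aestronglyMeasurable.aemeasurable
  have hc := h.isSmoothDensity.1.continuous
  have h1 : Integrable (fun ω => g (U ω)) P ↔ Integrable g (P.map U) :=
    (integrable_map_measure hg.aestronglyMeasurable hm).symm
  rw [h1, h.isSmoothDensity.2.2, integrable_withDensity_iff_integrable_smul'
    hc.measurable.ennreal_ofReal (Eventually.of_forall fun _ => ENNReal.ofReal_lt_top)]
  simp [ENNReal.toReal_ofReal (smoothed_nonneg _ _ _)]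

theorem integral_comp (h : IsSmoothing U A τ P) {g : ℝ → ℝ} (hg : Continuous g) :
    ∫ ω, g (U ω) ∂P = ∫ x, smoothed τ (P.map A) x * g x := by
  have hm := h.memLp.aestronglyMeasurable.aemeasurable
  have hc := h.isSmoothDensity.1.continuous
  have h1 : ∫ ω, g (U ω) ∂P = ∫ x, g x ∂(P.map U) :=
    (integral_map hm hg.aestronglyMeasurable).symm
  rw [h1, h.isSmoothDensity.2.2, integral_withDensity_eq_integral_toReal_smul
    hc.measurable.ennreal_ofReal (Eventually.of_forall fun _ => ENNReal.ofReal_lt_top)]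
  simp [ENNReal.toReal_ofReal (smoothed_nonneg _ _ _)]

theorem smoothed_mul_score (h : IsSmoothing U A τ P) (x : ℝ) :
    smoothed τ (P.map A) x * score U P x = smoothedDeriv τ (P.map A) x := by
  have := h.isProbabilityMeasure_map
  rw [h.score_eq, mul_div_cancel₀ _ (smoothed_pos h.pos h.integrable_sq_map x).ne']

/-- Since `p ρ = p'`, this is the integral over the line of the derivative of an integrable
function. -/
theorem integral_score (h : IsSmoothing U A τ P) : ∫ ω, score U P (U ω) ∂P = 0 := by
  have := h.isProbabilityMeasure_map
  rw [h.integral_comp h.continuous_score]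
  simp_rw [h.smoothed_mul_score]
  refine integral_eq_zero_of_hasDerivAt_of_integrable (hasDerivAt_smoothed h.pos) ?_ ?_
  · have := (h.integrable_comp_iff h.continuous_score).1 (h.memLp_score.integrable one_le_two)
    simpa only [h.smoothed_mul_score] using this
  · simpa using (h.integrable_comp_iff (continuous_const (y := (1 : ℝ)))).1 (integrable_const 1)

/-- Integration by parts: `∫ x p' = -∫ p`. -/
theorem integral_mul_score (h : IsSmoothing U A τ P) :
    ∫ ω, U ω * score U P (U ω) ∂P = -1 := by
  have := h.isProbabilityMeasure_map
  have hc : Continuous fun x => x * score U P x := continuous_id.mul h.continuous_score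
  have hone : ∫ x, smoothed τ (P.map A) x = 1 := by
    simpa using (h.integral_comp (continuous_const (y := (1 : ℝ)))).symm
  have hi0 : Integrable (smoothed τ (P.map A)) := by
    simpa using (h.integrable_comp_iff (continuous_const (y := (1 : ℝ)))).1 (integrable_const 1)
  have hi1 := (h.integrable_comp_iff continuous_id).1 (h.memLp.integrable one_le_two)
  have hi2 := (h.integrable_comp_iff hc).1 (h.memLp.integrable_mul h.memLp_score)
  have hre : ∀ x, smoothed τ (P.map A) x * (x * score U P x)
      = x * smoothedDeriv τ (P.map A) x := fun x => by
    rw [← h.smoothed_mul_score]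
    ring
  simp_rw [hre] at hi2
  have hibp := integral_mul_deriv_eq_deriv_mul_of_integrable (u := fun x : ℝ => x)
    (u' := fun _ => 1) (v := smoothed τ (P.map A)) (v' := smoothedDeriv τ (P.map A))
    (fun x _ => hasDerivAt_id x) (fun x _ => hasDerivAt_smoothed h.pos x) hi2
    (by simpa [Pi.mul_def] using hi0) (by simpa [Pi.mul_def, mul_comm] using hi1)
  rw [h.integral_comp hc]
  simp_rw [hre]
  rw [hibp]
  simp [hone]

/-- A constant `U = c` would give `E U ρ = c E ρ = 0`, against the value `-1`. -/
theorem variance_pos (h : IsSmoothing U A τ P) : 0 < variance U P := by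
  have hi := h.memLp_score.integrable one_le_two
  refine lt_of_le_of_ne (variance_nonneg _ _) fun h0 => ?_
  have hae : ∀ᵐ ω ∂P, U ω = ∫ ω, U ω ∂P := by
    have hev : evariance U P = 0 := by
      rw [← h.memLp.ofReal_variance_eq, ← h0, ENNReal.ofReal_zero]
    exact (evariance_eq_zero_iff h.memLp.aestronglyMeasurable.aemeasurable).1 hev
  have : ∫ ω, U ω * score U P (U ω) ∂P = ∫ ω, (∫ ω, U ω ∂P) * score U P (U ω) ∂P :=
    integral_congr_ae (by filter_upwards [hae] with ω hω; rw [← hω])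
  rw [h.integral_mul_score, integral_const_mul, h.integral_score] at this
  norm_num at this

/-- The standardised Fisher information is dominated by the `L²` distance of the score to any
affine function. -/
theorem stdFisherInfo_le (h : IsSmoothing U A τ P) (a b : ℝ) :
    stdFisherInfo U P
      ≤ variance U P * ∫ ω, (score U P (U ω) - (a + b * U ω)) ^ 2 ∂P := by
  have hs := h.memLp_score
  have hs2 := hs.integrable_sq
  have hs1 := hs.integrable one_le_two
  have hU1 := h.memLp.integrable one_le_two
  have hU2 := h.memLp.integrable_sq
  have hUs : Integrable (fun ω => U ω * score U P (U ω)) P := h.memLp.integrable_mul hs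
  have hexp : ∫ ω, (score U P (U ω) - (a + b * U ω)) ^ 2 ∂P
      = fisherInfo U P + a ^ 2 + 2 * a * b * (∫ ω, U ω ∂P) + b ^ 2 * (∫ ω, U ω ^ 2 ∂P)
        + 2 * b := by
    have h1 : ∀ ω, (score U P (U ω) - (a + b * U ω)) ^ 2
        = score U P (U ω) ^ 2 + (-2 * a) * score U P (U ω)
          + (-2 * b) * (U ω * score U P (U ω)) + b ^ 2 * U ω ^ 2 + (2 * a * b) * U ω + a ^ 2 :=
      fun ω => by ring
    simp_rw [h1]
    rw [integral_add (by fun_prop) (by fun_prop), integral_add (by fun_prop) (by fun_prop),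
      integral_add (by fun_prop) (by fun_prop), integral_add (by fun_prop) (by fun_prop),
      integral_add (by fun_prop) (by fun_prop), integral_const_mul, integral_const_mul,
      integral_const_mul, integral_const_mul, h.integral_score, h.integral_mul_score, fisherInfo]
    simp
    ring
  have hvar : variance U P = ∫ ω, U ω ^ 2 ∂P - (∫ ω, U ω ∂P) ^ 2 := variance_eq_sub h.memLp
  have hpos := h.variance_pos
  rw [stdFisherInfo, hexp]
  have hq : ∫ ω, U ω ^ 2 ∂P = variance U P + (∫ ω, U ω ∂P) ^ 2 := by linarith
  rw [hq]
  generalize variance U P = v at *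
  -- With `m` the mean, the right side minus the left is `(b v + 1)² + v (a + b m)²`.
  nlinarith [sq_nonneg (b * v + 1), mul_nonneg hpos.le (sq_nonneg (a + b * ∫ ω, U ω ∂P))]

end IsSmoothing

end Smoothing

/-! ### Stability of additivity on an interval -/

/-- Hyers–Ulam stability on an interval. Subtracting the linear function that agrees with `f` at `R`
gives `g` with `g R = 0`. Let `M` be the maximum of `|g|`. Doubling gives `2|g| ≤ M + δ` on the half
interval, and a shift by `±R` brings any other point there at cost `δ`. Hence `2M ≤ M + 3δ`. -/
theorem abs_sub_linear_le_of_almost_additive {f : ℝ → ℝ} (hf : Continuous f) {R δ : ℝ}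
    (hR : 0 < R)
    (h : ∀ s r, |s| ≤ R → |r| ≤ R → |f (s + r) - f s - f r| ≤ δ) {x : ℝ} (hx : |x| ≤ R) :
    |f x - f R / R * x| ≤ 3 * δ := by
  set g : ℝ → ℝ := fun x => f x - f R / R * x with hg
  have hgc : Continuous fun x => |g x| := by fun_prop
  have hgR : g R = 0 := by simp [hg, div_mul_cancel₀ _ hR.ne']
  have hadd : ∀ s r, |s| ≤ R → |r| ≤ R → |g (s + r) - g s - g r| ≤ δ := fun s r hs hr => by
    have e : g (s + r) - g s - g r = f (s + r) - f s - f r := by simp only [hg]; ring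
    rw [e]
    exact h s r hs hr
  obtain ⟨x₀, hx₀, hmax⟩ := (isCompact_Icc (a := -R) (b := R)).exists_isMaxOn
    ⟨0, by constructor <;> linarith⟩ hgc.continuousOn
  have hM : ∀ y, |y| ≤ R → |g y| ≤ |g x₀| := fun y hy => hmax (abs_le.1 hy)
  have hhalf : ∀ y, |y| ≤ R / 2 → 2 * |g y| ≤ |g x₀| + δ := fun y hy => by
    have h1 := hadd y y (by linarith) (by linarith)
    have h2 := hM (y + y) (by rw [← two_mul, abs_mul, abs_two]; linarith)
    have h3 : 2 * |g y| = |g (y + y) - (g (y + y) - g y - g y)| := by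
      rw [show g (y + y) - (g (y + y) - g y - g y) = 2 * g y by ring, abs_mul, abs_two]
    rw [h3]
    exact (abs_sub _ _).trans (add_le_add h2 h1)
  have hδ : 0 ≤ δ := (abs_nonneg _).trans (h 0 0 (by simpa using hR.le) (by simpa using hR.le))
  have hall : ∀ y, |y| ≤ R → 2 * |g y| ≤ |g x₀| + 3 * δ := fun y hy => by
    obtain ⟨hy1, hy2⟩ := abs_le.1 hy
    have hRR : |R| ≤ R := (abs_of_pos hR).le
    rcases le_total |y| (R / 2) with hc | hc
    · linarith [hhalf y hc]
    rcases le_total 0 y with h0 | h0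
    · rw [abs_of_nonneg h0] at hc
      have hs : |y - R| ≤ R / 2 := abs_le.2 ⟨by linarith, by linarith⟩
      have h1 := hadd (y - R) R (by linarith) hRR
      rw [sub_add_cancel, hgR, sub_zero] at h1
      have h2 := abs_sub_abs_le_abs_sub (g y) (g (y - R))
      linarith [hhalf _ hs]
    · rw [abs_of_nonpos h0] at hc
      have hs : |y + R| ≤ R / 2 := abs_le.2 ⟨by linarith, by linarith⟩
      have h1 := hadd y R hy hRR
      rw [hgR, sub_zero, abs_sub_comm] at h1
      have h2 := abs_sub_abs_le_abs_sub (g y) (g (y + R))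
      linarith [hhalf _ hs]
  have h1 := hall x₀ (abs_le.2 hx₀)
  have h2 := hM x hx
  show |g x| ≤ 3 * δ
  linarith

/-- If `a F(x) + b G(y) - k(a x + b y)` is uniformly small on a large box, then `F` is uniformly
close to an affine function. -/
theorem exists_affine_approx_of_functional_eq {F G k : ℝ → ℝ} (hF : Continuous F) {a b b₀ R δ : ℝ}
    (hb₀ : 0 < b₀) (ha : b₀ ≤ a) (hb : b₀ ≤ b) (ha1 : a ≤ 1) (hR : 0 < R)
    (h : ∀ x y, |x| ≤ 2 * R + R / b₀ → |y| ≤ 2 * R + R / b₀ →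
      |a * F x + b * G y - k (a * x + b * y)| ≤ δ) :
    ∃ B : ℝ, ∀ x, |x| ≤ R → |F x - (F 0 + B * x)| ≤ 12 * δ / b₀ := by
  have ha0 : 0 < a := hb₀.trans_le ha
  have hb0 : 0 < b := hb₀.trans_le hb
  have hRb : 0 < R / b₀ := by positivity
  refine ⟨(F R - F 0) / R, fun x hx => ?_⟩
  have key : ∀ s r, |s| ≤ R → |r| ≤ R →
      |(F (s + r) - F 0) - (F s - F 0) - (F r - F 0)| ≤ 4 * δ / b₀ := fun s r hs hr => by
    have hsr : |s + r| ≤ 2 * R + R / b₀ := by linarith [abs_add_le s r]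
    -- With `a r + b y = 0`, the points `(s + r, y)` and `(s, 0)` share one argument of `k`, as do
    -- `(r, y)` and `(0, 0)`. The alternating sum of the four bounds cancels `G` and `k`. The size
    -- of `y` accounts for the `R / b₀` in the box.
    set y := -(a * r / b) with hy
    have hyb : |y| ≤ 2 * R + R / b₀ := by
      have : |y| ≤ R / b₀ := by
        rw [hy, abs_neg, abs_div, abs_mul, abs_of_pos ha0, abs_of_pos hb0]
        refine div_le_div₀ hR.le ?_ hb₀ hb
        nlinarith [abs_nonneg r]
      linarith
    have e1 : a * (s + r) + b * y = a * s + b * 0 := by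
      rw [hy]; field_simp; ring
    have e2 : a * r + b * y = a * 0 + b * 0 := by
      rw [hy]; field_simp; ring
    have h0 : |(0 : ℝ)| ≤ 2 * R + R / b₀ := by rw [abs_zero]; linarith
    have h1 := h (s + r) y hsr hyb
    have h2 := h s 0 (by linarith) h0
    have h3 := h r y (by linarith) hyb
    have h4 := h 0 0 h0 h0
    rw [e1] at h1
    rw [e2] at h3
    rw [abs_le] at h1 h2 h3 h4
    have hmain : |a * ((F (s + r) - F 0) - (F s - F 0) - (F r - F 0))| ≤ 4 * δ := by
      rw [abs_le]
      constructor <;> nlinarith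
    rw [abs_mul, abs_of_pos ha0] at hmain
    rw [le_div_iff₀ hb₀]
    nlinarith [abs_nonneg ((F (s + r) - F 0) - (F s - F 0) - (F r - F 0))]
  have hfin := abs_sub_linear_le_of_almost_additive (f := fun x => F x - F 0)
    (by fun_prop) hR key hx
  calc |F x - (F 0 + (F R - F 0) / R * x)| = |F x - F 0 - (F R - F 0) / R * x| := by
        congr 1; ring
    _ ≤ 3 * (4 * δ / b₀) := hfin
    _ = _ := by ring

/-! ### Gaussian perturbations of a pair -/

/-- `X = S + Z_S` and `Y = T + Z_T` are Gaussian perturbations of variables `S`, `T` with second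
moments at most `K`. -/
structure IsPerturbedPair {Ω : Type*} [MeasurableSpace Ω] (S T ZS ZT X Y : Ω → ℝ) (τ : ℝ≥0)
    (K : ℝ) (P : Measure Ω) : Prop where
  pos : 0 < τ
  memLp_left : MemLp S 2 P
  memLp_right : MemLp T 2 P
  integral_sq_left : ∫ ω, S ω ^ 2 ∂P ≤ K
  integral_sq_right : ∫ ω, T ω ^ 2 ∂P ≤ K
  noise : IsGaussianPerturbation S T ZS ZT τ P
  eq_left : X = fun ω => S ω + ZS ω
  eq_right : Y = fun ω => T ω + ZT ω

namespace IsPerturbedPair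

variable {Ω : Type*} [MeasurableSpace Ω] {P : Measure Ω} {S T ZS ZT X Y : Ω → ℝ} {τ : ℝ≥0} {K : ℝ}

theorem nonneg (h : IsPerturbedPair S T ZS ZT X Y τ K P) : 0 ≤ K :=
  (integral_nonneg fun _ => sq_nonneg _).trans h.integral_sq_left

/-- As `S` and `T` may be dependent, the bound comes from `(u + v)² ≤ 2u² + 2v²`. -/
theorem integral_mix_sq_le (h : IsPerturbedPair S T ZS ZT X Y τ K P) {β : ℝ} (h0 : 0 ≤ β)
    (h1 : β ≤ 1) : ∫ ω, mix S T β ω ^ 2 ∂P ≤ 2 * K := by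
  have hS := h.memLp_left.integrable_sq
  have hT := h.memLp_right.integrable_sq
  have hmix : MemLp (mix S T β) 2 P :=
    (h.memLp_left.const_mul (√β)).add (h.memLp_right.const_mul (√(1 - β)))
  have hle : ∀ ω, mix S T β ω ^ 2 ≤ 2 * β * S ω ^ 2 + 2 * (1 - β) * T ω ^ 2 := fun ω => by
    have e1 : √β ^ 2 = β := Real.sq_sqrt h0
    have e2 : √(1 - β) ^ 2 = 1 - β := Real.sq_sqrt (by linarith)
    have : 2 * β * S ω ^ 2 + 2 * (1 - β) * T ω ^ 2
        = 2 * (√β * S ω) ^ 2 + 2 * (√(1 - β) * T ω) ^ 2 := by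
      rw [mul_pow, mul_pow, e1, e2]; ring
    rw [this, mix]
    nlinarith [sq_nonneg (√β * S ω - √(1 - β) * T ω)]
  refine (integral_mono hmix.integrable_sq ((hS.const_mul _).add (hT.const_mul _)) hle).trans ?_
  simp only [Pi.add_apply]
  rw [integral_add (hS.const_mul _) (hT.const_mul _), integral_const_mul, integral_const_mul]
  nlinarith [h.integral_sq_left, h.integral_sq_right]

variable [IsProbabilityMeasure P]

theorem isSmoothing_left (h : IsPerturbedPair S T ZS ZT X Y τ K P) : IsSmoothing X S τ P := by
  rw [h.eq_left]
  exact isSmoothing_add h.pos h.memLp_left h.noise.law_left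
    (h.noise.indep.comp measurable_fst measurable_fst)

theorem isSmoothing_right (h : IsPerturbedPair S T ZS ZT X Y τ K P) : IsSmoothing Y T τ P := by
  rw [h.eq_right]
  exact isSmoothing_add h.pos h.memLp_right h.noise.law_right
    (h.noise.indep.comp measurable_snd measurable_snd)

/-- The squares of the coefficients sum to one, so the mixed noise is again `N(0, τ)`, with the same
`τ` for every `β`; this keeps all score bounds uniform in `β`. -/
theorem isSmoothing_mix (h : IsPerturbedPair S T ZS ZT X Y τ K P) {β : ℝ} (h0 : 0 ≤ β)
    (h1 : β ≤ 1) : IsSmoothing (mix X Y β) (mix S T β) τ P := by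
  have e1 : √β ^ 2 = β := Real.sq_sqrt h0
  have e2 : √(1 - β) ^ 2 = 1 - β := Real.sq_sqrt (by linarith)
  have hlaw1 := gaussianReal_const_mul h.noise.law_left (√β)
  have hlaw2 := gaussianReal_const_mul h.noise.law_right (√(1 - β))
  have hZind : IndepFun (fun ω => √β * ZS ω) (fun ω => √(1 - β) * ZT ω) P :=
    h.noise.indep_noise.comp (φ := fun z => √β * z) (ψ := fun z => √(1 - β) * z)
      (by fun_prop) (by fun_prop)
  have hlaw : HasLaw (mix ZS ZT β) (gaussianReal 0 τ) P := by
    refine ⟨hlaw1.aemeasurable.add hlaw2.aemeasurable, ?_⟩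
    have := gaussianReal_add_gaussianReal_of_indepFun hZind hlaw1.map_eq hlaw2.map_eq
    have hv : (NNReal.mk (√β ^ 2) (sq_nonneg _) * τ + NNReal.mk (√(1 - β) ^ 2) (sq_nonneg _) * τ
        : ℝ≥0) = τ := by
      ext
      push_cast
      simp only [e1, e2]
      ring
    rw [hv, mul_zero, mul_zero, add_zero] at this
    exact this
  have hind : IndepFun (mix S T β) (mix ZS ZT β) P :=
    h.noise.indep.comp (φ := fun q : ℝ × ℝ => √β * q.1 + √(1 - β) * q.2)
      (ψ := fun q : ℝ × ℝ => √β * q.1 + √(1 - β) * q.2) (by fun_prop) (by fun_prop)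
  have heq : mix X Y β = fun ω => mix S T β ω + mix ZS ZT β ω := by
    ext ω
    simp only [mix, h.eq_left, h.eq_right]
    ring
  rw [heq]
  exact isSmoothing_add h.pos
    ((h.memLp_left.const_mul (√β)).add (h.memLp_right.const_mul (√(1 - β)))) hlaw hind

theorem memLp_scoreDefect (h : IsPerturbedPair S T ZS ZT X Y τ K P) {β : ℝ} (h0 : 0 ≤ β)
    (h1 : β ≤ 1) : MemLp (scoreDefect X Y β P) 2 P :=
  ((h.isSmoothing_left.memLp_score.const_mul (√β)).add
    (h.isSmoothing_right.memLp_score.const_mul (√(1 - β)))).sub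
    (h.isSmoothing_mix h0 h1).memLp_score

end IsPerturbedPair

theorem gaussianReal_preimage_add_Icc_ge {τ : ℝ≥0} (hτ : 0 < τ) {R x₀ r : ℝ} (hx₀ : |x₀| ≤ R)
    (hr1 : r ≤ 1) (s : ℝ) :
    ENNReal.ofReal (gaussianPDFReal 0 τ 0 * Real.exp (-((R + 1) ^ 2 / τ))
        * Real.exp (-(s ^ 2 / τ))) * ENNReal.ofReal r
      ≤ gaussianReal 0 τ ((fun z => s + z) ⁻¹' Set.Icc x₀ (x₀ + r)) := by
  have hτ' : (0 : ℝ) < τ := hτ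
  rw [← Measure.map_apply (by fun_prop) measurableSet_Icc, gaussianReal_map_const_add,
    gaussianReal_apply _ hτ.ne']
  have hvol : ENNReal.ofReal r = volume (Set.Icc x₀ (x₀ + r)) := by simp
  rw [hvol, ← setLIntegral_const]
  refine setLIntegral_mono' measurableSet_Icc fun x hx => ?_
  rw [gaussianPDF]
  refine ENNReal.ofReal_le_ofReal ?_
  have hxR : |x| ≤ |R + 1| := by
    refine le_trans ?_ (le_abs_self _)
    rw [abs_le] at hx₀ ⊢
    constructor <;> linarith [hx.1, hx.2]
  have he : gaussianPDFReal (0 + s) τ x = gaussianPDFReal 0 τ (x - s) := by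
    simp [gaussianPDFReal]
  rw [he]
  refine le_trans ?_ (gaussianPDFReal_sub_ge hτ x s)
  have hg := gaussianPDFReal_nonneg 0 τ 0
  gcongr _ * Real.exp (-(?_ / τ)) * _
  exact sq_le_sq.2 hxR

/-- The joint law of a perturbed pair charges every small square in a box. -/
theorem exists_le_measure_square {τ : ℝ≥0} (hτ : 0 < τ) (K R : ℝ) :
    ∃ c : ℝ, 0 < c ∧ ∀ (Ω : Type*) [MeasurableSpace Ω] (P : Measure Ω) [IsProbabilityMeasure P]
      (S T ZS ZT X Y : Ω → ℝ), IsPerturbedPair S T ZS ZT X Y τ K P →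
      ∀ x₀ y₀ r, |x₀| ≤ R → |y₀| ≤ R → 0 ≤ r → r ≤ 1 →
        c * r ^ 2 ≤ P.real {ω | X ω ∈ Set.Icc x₀ (x₀ + r) ∧ Y ω ∈ Set.Icc y₀ (y₀ + r)} := by
  have hτ' : (0 : ℝ) < τ := hτ
  have hg := gaussianPDFReal_pos 0 τ 0 hτ.ne'
  set m := gaussianPDFReal 0 τ 0 * Real.exp (-((R + 1) ^ 2 / τ)) with hm
  have hm0 : 0 < m := by positivity
  refine ⟨m ^ 2 * Real.exp (-(2 * K / τ)), by positivity, ?_⟩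
  intro Ω _ P _ S T ZS ZT X Y h x₀ y₀ r hx₀ hy₀ hr hr1
  have hSm := h.memLp_left.aestronglyMeasurable.aemeasurable
  have hTm := h.memLp_right.aestronglyMeasurable.aemeasurable
  have hZS := h.noise.law_left
  have hZT := h.noise.law_right
  set D : Set ((ℝ × ℝ) × (ℝ × ℝ)) :=
    {q | q.1.1 + q.2.1 ∈ Set.Icc x₀ (x₀ + r) ∧ q.1.2 + q.2.2 ∈ Set.Icc y₀ (y₀ + r)} with hD
  have hDm : MeasurableSet D :=
    (measurableSet_Icc.preimage (by fun_prop : Measurable fun q : (ℝ × ℝ) × (ℝ × ℝ) =>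
      q.1.1 + q.2.1)).inter (measurableSet_Icc.preimage (by fun_prop :
        Measurable fun q : (ℝ × ℝ) × (ℝ × ℝ) => q.1.2 + q.2.2))
  have hjoint : P.map (fun ω => ((S ω, T ω), (ZS ω, ZT ω)))
      = (P.map fun ω => (S ω, T ω)).prod ((gaussianReal 0 τ).prod (gaussianReal 0 τ)) := by
    rw [(indepFun_iff_map_prod_eq_prod_map_map (hSm.prodMk hTm)
      (hZS.aemeasurable.prodMk hZT.aemeasurable)).1 h.noise.indep,
      (indepFun_iff_map_prod_eq_prod_map_map hZS.aemeasurable hZT.aemeasurable).1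
        h.noise.indep_noise, hZS.map_eq, hZT.map_eq]
  -- Given `(S, T)`, the variables `X` and `Y` are independent, so the square has product
  -- probability.
  have hev : P {ω | X ω ∈ Set.Icc x₀ (x₀ + r) ∧ Y ω ∈ Set.Icc y₀ (y₀ + r)}
      = ∫⁻ ω, gaussianReal 0 τ ((fun z => S ω + z) ⁻¹' Set.Icc x₀ (x₀ + r))
        * gaussianReal 0 τ ((fun z => T ω + z) ⁻¹' Set.Icc y₀ (y₀ + r)) ∂P := by
    have h1 : P {ω | X ω ∈ Set.Icc x₀ (x₀ + r) ∧ Y ω ∈ Set.Icc y₀ (y₀ + r)}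
        = P.map (fun ω => ((S ω, T ω), (ZS ω, ZT ω))) D := by
      rw [Measure.map_apply_of_aemeasurable ((hSm.prodMk hTm).prodMk
        (hZS.aemeasurable.prodMk hZT.aemeasurable)) hDm]
      simp [hD, h.eq_left, h.eq_right]
    rw [h1, hjoint, Measure.prod_apply hDm,
      lintegral_map' (measurable_measure_prodMk_left hDm).aemeasurable (hSm.prodMk hTm)]
    refine lintegral_congr fun ω => ?_
    rw [← Measure.prod_prod]
    rfl
  -- Jensen's inequality for `exp`: only `E (S² + T²)` enters, so dependence of `S` and `T` is
  -- harmless.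
  have hexp : Real.exp (-(2 * K / τ))
      ≤ ∫ ω, Real.exp (-(S ω ^ 2 / τ)) * Real.exp (-(T ω ^ 2 / τ)) ∂P := by
    have hS2 := h.memLp_left.integrable_sq
    have hT2 := h.memLp_right.integrable_sq
    have hSi : Integrable (fun ω => -(S ω ^ 2 / τ)) P := (hS2.div_const _).neg
    have hTi : Integrable (fun ω => -(T ω ^ 2 / τ)) P := (hT2.div_const _).neg
    have hi := hSi.add hTi
    have hie : Integrable (fun ω => Real.exp (-(S ω ^ 2 / τ) + -(T ω ^ 2 / τ))) P := by
      refine Integrable.of_bound (C := 1) (Real.continuous_exp.comp_aestronglyMeasurable hi.1)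
        (Eventually.of_forall fun ω => ?_)
      rw [Real.norm_of_nonneg (Real.exp_pos _).le, Real.exp_le_one_iff]
      have h1 : 0 ≤ S ω ^ 2 / τ := by positivity
      have h2 : 0 ≤ T ω ^ 2 / τ := by positivity
      linarith
    have hj := convexOn_exp.map_integral_le Real.continuous_exp.continuousOn isClosed_univ
      (Eventually.of_forall fun ω => Set.mem_univ _) hi hie
    simp_rw [← Real.exp_add]
    refine le_trans (Real.exp_le_exp.2 ?_) hj
    simp only [Pi.add_apply]
    rw [integral_add hSi hTi, integral_neg, integral_neg,
      integral_div, integral_div, ← neg_add, neg_le_neg_iff, ← add_div]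
    gcongr
    linarith [h.integral_sq_left, h.integral_sq_right]
  have hlow : ENNReal.ofReal (m ^ 2 * Real.exp (-(2 * K / τ)) * r ^ 2)
      ≤ P {ω | X ω ∈ Set.Icc x₀ (x₀ + r) ∧ Y ω ∈ Set.Icc y₀ (y₀ + r)} := by
    rw [hev]
    have hie : Integrable (fun ω => Real.exp (-(S ω ^ 2 / τ)) * Real.exp (-(T ω ^ 2 / τ))) P := by
      by_contra hn
      rw [integral_undef hn] at hexp
      exact absurd hexp (not_le.2 (Real.exp_pos _))
    calc ENNReal.ofReal (m ^ 2 * Real.exp (-(2 * K / τ)) * r ^ 2)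
        ≤ ENNReal.ofReal (∫ ω, m ^ 2 * r ^ 2 *
            (Real.exp (-(S ω ^ 2 / τ)) * Real.exp (-(T ω ^ 2 / τ))) ∂P) := by
          refine ENNReal.ofReal_le_ofReal ?_
          rw [integral_const_mul]
          calc m ^ 2 * Real.exp (-(2 * K / τ)) * r ^ 2
              = m ^ 2 * r ^ 2 * Real.exp (-(2 * K / τ)) := by ring
            _ ≤ _ := by gcongr
      _ = ∫⁻ ω, ENNReal.ofReal (m ^ 2 * r ^ 2 *
            (Real.exp (-(S ω ^ 2 / τ)) * Real.exp (-(T ω ^ 2 / τ)))) ∂P :=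
          ofReal_integral_eq_lintegral_ofReal (hie.const_mul _)
            (Eventually.of_forall fun ω => by positivity)
      _ ≤ _ := by
          refine lintegral_mono fun ω => ?_
          refine le_trans (le_of_eq ?_) (mul_le_mul'
            (gaussianReal_preimage_add_Icc_ge hτ hx₀ hr1 (S ω))
            (gaussianReal_preimage_add_Icc_ge hτ hy₀ hr1 (T ω)))
          rw [← hm, ← ENNReal.ofReal_mul (by positivity), ← ENNReal.ofReal_mul (by positivity),
            ← ENNReal.ofReal_mul (by positivity)]
          congr 1
          ring
  exact (ENNReal.ofReal_le_iff_le_toReal (measure_ne_top _ _)).1 hlow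

/-! ### Uniform score bounds, and Fisher information from an affine approximation -/

namespace IsSmoothing

variable {Ω : Type*} [MeasurableSpace Ω] {P : Measure Ω} [IsProbabilityMeasure P]
  {U A : Ω → ℝ} {τ : ℝ≥0}

theorem exists_abs_score_le {τ : ℝ≥0} (hτ : 0 < τ) (K : ℝ) :
    ∃ C : ℝ, 0 < C ∧ ∀ (Ω : Type*) [MeasurableSpace Ω] (P : Measure Ω) [IsProbabilityMeasure P]
      (U A : Ω → ℝ), IsSmoothing U A τ P → ∫ ω, A ω ^ 2 ∂P ≤ K →
      ∀ x, |score U P x| ≤ C * (1 + |x|) := by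
  obtain ⟨C, hC, hb⟩ := exists_abs_smoothedDeriv_div_le hτ K
  refine ⟨C, hC, fun Ω _ P _ U A h hK x => ?_⟩
  have := h.isProbabilityMeasure_map
  rw [h.score_eq]
  exact hb _ h.integrable_sq_map (h.integral_sq_map.trans_le hK) x

theorem exists_abs_score_sub_le {τ : ℝ≥0} (hτ : 0 < τ) (K R : ℝ) :
    ∃ L : ℝ, 0 < L ∧ ∀ (Ω : Type*) [MeasurableSpace Ω] (P : Measure Ω) [IsProbabilityMeasure P]
      (U A : Ω → ℝ), IsSmoothing U A τ P → ∫ ω, A ω ^ 2 ∂P ≤ K →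
      ∀ x y, |x| ≤ R → |y| ≤ R → |score U P x - score U P y| ≤ L * |x - y| := by
  obtain ⟨L, hL, hb⟩ := exists_abs_smoothedDeriv_div_sub_le hτ K R
  refine ⟨L, hL, fun Ω _ P _ U A h hK x y hx hy => ?_⟩
  have := h.isProbabilityMeasure_map
  rw [h.score_eq, h.score_eq]
  exact hb _ h.integrable_sq_map (h.integral_sq_map.trans_le hK) x y hx hy

/-- If the score is within `e` of an affine function on `[-R, R]`, then the standardised Fisher
information is controlled by `e` and the tail of the second moment beyond `R`. -/
theorem stdFisherInfo_le_of_affine_approx (h : IsSmoothing U A τ P) {V C B R e : ℝ}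
    (hV : variance U P ≤ V) (hR : 1 ≤ R) (he : e ≤ 1)
    (hC : ∀ x, |score U P x| ≤ C * (1 + |x|))
    (happ : ∀ x, |x| ≤ R → |score U P x - (score U P 0 + B * x)| ≤ e) :
    stdFisherInfo U P
      ≤ V * (e ^ 2 + (6 * C + 1) ^ 2 * ∫ ω in {ω | R ≤ |U ω|}, U ω ^ 2 ∂P) := by
  have h0 : |score U P 0| ≤ C := by simpa using hC 0
  have hC0 : 0 ≤ C := (abs_nonneg _).trans h0
  -- Comparison at the point `1`, which lies in the interval because `R ≥ 1`.
  have hB : |B| ≤ 3 * C + 1 := by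
    have h1 : |score U P 1| ≤ 2 * C := by
      have := hC 1
      rw [abs_one] at this
      linarith
    have h2 := happ 1 (by rwa [abs_one])
    rw [abs_le] at h0 h1 h2 ⊢
    constructor <;> linarith
  have hU2 := h.memLp.integrable_sq
  have hset : NullMeasurableSet {ω | R ≤ |U ω|} P :=
    nullMeasurableSet_le aemeasurable_const h.memLp.aestronglyMeasurable.norm.aemeasurable
  have hpt : ∀ ω, (score U P (U ω) - (score U P 0 + B * U ω)) ^ 2
      ≤ e ^ 2 + (6 * C + 1) ^ 2 * {ω | R ≤ |U ω|}.indicator (fun ω => U ω ^ 2) ω := fun ω => by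
    by_cases hω : R ≤ |U ω|
    -- Here `|U| ≥ 1`, so the score, its value at `0` and the linear term are at most `2C|U|`,
    -- `C|U|` and `(3C + 1)|U|`.
    · rw [Set.indicator_of_mem (by exact hω), ← sq_abs (U ω), ← mul_pow]
      refine le_add_of_nonneg_of_le (sq_nonneg _) (sq_le_sq' ?_ ?_)
      all_goals
        have h1 := abs_le.1 (hC (U ω))
        have h2 := abs_le.1 h0
        have h3 : |B * U ω| ≤ (3 * C + 1) * |U ω| := by
          rw [abs_mul]
          gcongr
        rw [abs_le] at h3
        have h4 : C * 1 ≤ C * |U ω| := mul_le_mul_of_nonneg_left (hR.trans hω) hC0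
        nlinarith
    · rw [Set.indicator_of_notMem (by exact hω), mul_zero, add_zero]
      exact sq_le_sq' (by linarith [(abs_le.1 (happ _ (not_le.1 hω).le)).1])
        (abs_le.1 (happ _ (not_le.1 hω).le)).2
  have hint : ∫ ω, (score U P (U ω) - (score U P 0 + B * U ω)) ^ 2 ∂P
      ≤ e ^ 2 + (6 * C + 1) ^ 2 * ∫ ω in {ω | R ≤ |U ω|}, U ω ^ 2 ∂P := by
    have hind : Integrable ({ω | R ≤ |U ω|}.indicator fun ω => U ω ^ 2) P :=
      hU2.indicator₀ hset
    have hmem : MemLp (fun ω => score U P (U ω) - (score U P 0 + B * U ω)) 2 P :=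
      h.memLp_score.sub ((memLp_const (score U P 0)).add (h.memLp.const_mul B))
    refine (integral_mono hmem.integrable_sq
      ((integrable_const _).add (hind.const_mul _)) hpt).trans (le_of_eq ?_)
    simp only [Pi.add_apply]
    rw [integral_add (integrable_const _) (hind.const_mul _), integral_const_mul,
      integral_indicator₀ hset, integral_const]
    simp
  have hnn : 0 ≤ e ^ 2 + (6 * C + 1) ^ 2 * ∫ ω in {ω | R ≤ |U ω|}, U ω ^ 2 ∂P := by
    have : 0 ≤ ∫ ω in {ω | R ≤ |U ω|}, U ω ^ 2 ∂P := integral_nonneg fun _ => sq_nonneg _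
    positivity
  calc stdFisherInfo U P ≤ variance U P * _ := h.stdFisherInfo_le (score U P 0) B
    _ ≤ variance U P * _ := mul_le_mul_of_nonneg_left hint (variance_nonneg _ _)
    _ ≤ _ := mul_le_mul_of_nonneg_right hV hnn

/-- A crude bound that needs no smallness of the defect: it covers `β` near `0` or `1` and makes the
supremum defining `ν` finite. -/
theorem stdFisherInfo_le_of_growth (h : IsSmoothing U A τ P) {V C K : ℝ}
    (hV : variance U P ≤ V) (hC : ∀ x, |score U P x| ≤ C * (1 + |x|))
    (hK : ∫ ω, U ω ^ 2 ∂P ≤ K) :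
    stdFisherInfo U P ≤ V * (2 * C ^ 2 * (1 + K)) := by
  have hU2 := h.memLp.integrable_sq
  have hpt : ∀ ω, score U P (U ω) ^ 2 ≤ 2 * C ^ 2 * (1 + U ω ^ 2) := fun ω => by
    calc score U P (U ω) ^ 2 ≤ (C * (1 + |U ω|)) ^ 2 :=
          sq_le_sq' (abs_le.1 (hC _)).1 (abs_le.1 (hC _)).2
      _ = C ^ 2 * (1 + |U ω|) ^ 2 := by ring
      _ ≤ C ^ 2 * (2 * (1 + |U ω| ^ 2)) := by
          gcongr
          nlinarith [sq_nonneg (1 - |U ω|)]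
      _ = _ := by rw [sq_abs]; ring
  have hJ : fisherInfo U P ≤ 2 * C ^ 2 * (1 + K) := by
    refine (integral_mono h.memLp_score.integrable_sq
      (((integrable_const 1).add hU2).const_mul _) hpt).trans ?_
    simp only [Pi.add_apply]
    rw [integral_const_mul, integral_add (integrable_const _) hU2]
    gcongr
    simp
  have hJ0 : 0 ≤ fisherInfo U P := integral_nonneg fun _ => sq_nonneg _
  rw [stdFisherInfo]
  have := mul_le_mul hV hJ hJ0 ((variance_nonneg _ _).trans hV)
  linarith

end IsSmoothing

/-- A small defect in mean square is uniformly small on boxes. -/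
theorem exists_abs_scoreDefect_le {τ : ℝ≥0} (hτ : 0 < τ) (K R : ℝ) {δ : ℝ} (hδ : 0 < δ) :
    ∃ ε : ℝ, 0 < ε ∧ ∀ (Ω : Type*) [MeasurableSpace Ω] (P : Measure Ω) [IsProbabilityMeasure P]
      (S T ZS ZT X Y : Ω → ℝ), IsPerturbedPair S T ZS ZT X Y τ K P →
      ∀ β, 0 ≤ β → β ≤ 1 → Delta X Y β P < ε → ∀ x y, |x| ≤ R → |y| ≤ R →
        |√β * score X P x + √(1 - β) * score Y P y
          - score (mix X Y β) P (√β * x + √(1 - β) * y)| ≤ δ := by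
  obtain ⟨c, hc, hsq⟩ := exists_le_measure_square hτ K R
  -- The moment bound `2 * K` and the radius `2 * (R + 1)` cover `X`, `Y` and their mixture at once.
  obtain ⟨L, hL, hlip⟩ := IsSmoothing.exists_abs_score_sub_le hτ (2 * K) (2 * (R + 1))
  -- On a square of side `r` the two weighted scores change by at most `δ/4` in total, and the score
  -- of the mixture, whose argument moves by at most `2r`, by `δ/4`. A defect above `δ` at the
  -- corner thus stays at least `δ/2` on the square, and Markov's inequality bounds `Δ` below.
  set r := min 1 (δ / (8 * L)) with hr
  have hr0 : 0 < r := lt_min one_pos (by positivity)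
  have hr1 : r ≤ 1 := min_le_left _ _
  have hrL : L * r ≤ δ / 8 := by
    have : r ≤ δ / (8 * L) := min_le_right _ _
    rw [le_div_iff₀ (by positivity)] at this
    linarith
  refine ⟨(δ / 2) ^ 2 * (c * r ^ 2), by positivity, ?_⟩
  intro Ω _ P _ S T ZS ZT X Y h β hβ0 hβ1 hΔ x₀ y₀ hx₀ hy₀
  by_contra! hbig
  refine absurd hΔ (not_lt.2 ?_)
  have hK := h.nonneg
  have ha0 := Real.sqrt_nonneg β
  have hb0 := Real.sqrt_nonneg (1 - β)
  have ha1 : √β ≤ 1 := Real.sqrt_le_one.2 hβ1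
  have hb1 : √(1 - β) ≤ 1 := Real.sqrt_le_one.2 (by linarith)
  have hcomb : ∀ u v B, |u| ≤ B → |v| ≤ B → |√β * u + √(1 - β) * v| ≤ 2 * B :=
    fun u v B hu hv => by
      refine (abs_add_le _ _).trans ?_
      rw [abs_mul, abs_mul, abs_of_nonneg ha0, abs_of_nonneg hb0]
      nlinarith [abs_nonneg u, abs_nonneg v]
  have hsub : {ω | X ω ∈ Set.Icc x₀ (x₀ + r) ∧ Y ω ∈ Set.Icc y₀ (y₀ + r)}
      ⊆ {ω | (δ / 2) ^ 2 ≤ scoreDefect X Y β P ω ^ 2} := by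
    rintro ω ⟨hx, hy⟩
    have hR : 0 ≤ R := (abs_nonneg _).trans hx₀
    have hdx : |X ω - x₀| ≤ r := abs_le.2 ⟨by linarith [hx.1], by linarith [hx.2]⟩
    have hdy : |Y ω - y₀| ≤ r := abs_le.2 ⟨by linarith [hy.1], by linarith [hy.2]⟩
    have hXR : |X ω| ≤ R + 1 := by
      have := abs_sub_abs_le_abs_sub (X ω) x₀
      linarith
    have hYR : |Y ω| ≤ R + 1 := by
      have := abs_sub_abs_le_abs_sub (Y ω) y₀
      linarith
    have l1 := hlip Ω P X S h.isSmoothing_left (by linarith [h.integral_sq_left]) (X ω) x₀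
      (by linarith) (by linarith)
    have l2 := hlip Ω P Y T h.isSmoothing_right (by linarith [h.integral_sq_right]) (Y ω) y₀
      (by linarith) (by linarith)
    have l3 := hlip Ω P _ _ (h.isSmoothing_mix hβ0 hβ1) (h.integral_mix_sq_le hβ0 hβ1)
      (mix X Y β ω) (√β * x₀ + √(1 - β) * y₀) (hcomb _ _ _ hXR hYR)
      (hcomb _ _ _ (by linarith) (by linarith))
    have hdm : |mix X Y β ω - (√β * x₀ + √(1 - β) * y₀)| ≤ 2 * r := by
      have e : mix X Y β ω - (√β * x₀ + √(1 - β) * y₀)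
          = √β * (X ω - x₀) + √(1 - β) * (Y ω - y₀) := by rw [mix]; ring
      rw [e]
      exact hcomb _ _ _ hdx hdy
    have m1 : |score X P (X ω) - score X P x₀| ≤ δ / 8 :=
      l1.trans ((mul_le_mul_of_nonneg_left hdx hL.le).trans hrL)
    have m2 : |score Y P (Y ω) - score Y P y₀| ≤ δ / 8 :=
      l2.trans ((mul_le_mul_of_nonneg_left hdy hL.le).trans hrL)
    have m3 := l3.trans (mul_le_mul_of_nonneg_left hdm hL.le)
    have m12 := hcomb _ _ _ m1 m2
    have habs : δ / 2 ≤ |scoreDefect X Y β P ω| := by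
      rw [scoreDefect]
      set q := √β * score X P x₀ + √(1 - β) * score Y P y₀
        - score (mix X Y β) P (√β * x₀ + √(1 - β) * y₀) with hq
      set q' := √β * score X P (X ω) + √(1 - β) * score Y P (Y ω)
        - score (mix X Y β) P (mix X Y β ω) with hq'
      have hqq : |q - q'| ≤ δ / 2 := by
        have e : q - q' = (score (mix X Y β) P (mix X Y β ω)
            - score (mix X Y β) P (√β * x₀ + √(1 - β) * y₀))
            - (√β * (score X P (X ω) - score X P x₀)
              + √(1 - β) * (score Y P (Y ω) - score Y P y₀)) := by rw [hq, hq']; ring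
        rw [e]
        refine (abs_sub _ _).trans ?_
        linarith
      have := abs_sub_abs_le_abs_sub q q'
      linarith
    show (δ / 2) ^ 2 ≤ scoreDefect X Y β P ω ^ 2
    rw [← sq_abs (scoreDefect X Y β P ω)]
    gcongr
  calc (δ / 2) ^ 2 * (c * r ^ 2)
      ≤ (δ / 2) ^ 2 * P.real {ω | (δ / 2) ^ 2 ≤ scoreDefect X Y β P ω ^ 2} := by
        gcongr
        exact (hsq Ω P S T ZS ZT X Y h x₀ y₀ r hx₀ hy₀ hr0.le hr1).trans (measureReal_mono hsub)
    _ ≤ Delta X Y β P :=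
        mul_meas_ge_le_integral_of_nonneg (Eventually.of_forall fun _ => sq_nonneg _)
          (h.memLp_scoreDefect hβ0 hβ1).integrable_sq _

/-! ### Perturbed pairs with uniform tails -/

/-- `X = S + Z_S` and `Y = T + Z_T` are Gaussian perturbations of variables `S`, `T` with variances
at most `K`, and lie in the tail class of `ψ`. -/
structure IsTailPair {Ω : Type*} [MeasurableSpace Ω] (ψ : ℝ → ℝ) (S T ZS ZT X Y : Ω → ℝ) (τ : ℝ≥0)
    (K : ℝ) (P : Measure Ω) : Prop where
  pos : 0 < τ
  memLp_left : MemLp S 2 P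
  memLp_right : MemLp T 2 P
  variance_left : variance S P ≤ K
  variance_right : variance T P ≤ K
  noise : IsGaussianPerturbation S T ZS ZT τ P
  eq_left : X = fun ω => S ω + ZS ω
  eq_right : Y = fun ω => T ω + ZT ω
  tail_left : InTailClass ψ X P
  tail_right : InTailClass ψ Y P

section TailClass

variable {Ω : Type*} [MeasurableSpace Ω] {P : Measure Ω}
  {ψ : ℝ → ℝ} {S T ZS ZT X Y : Ω → ℝ} {τ : ℝ≥0} {K : ℝ}

theorem variance_add_gaussian {A Z : Ω → ℝ} (hA : MemLp A 2 P)
    (hZ : HasLaw Z (gaussianReal 0 τ) P) (hind : IndepFun A Z P) :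
    variance (fun ω => A ω + Z ω) P = variance A P + τ := by
  rw [hind.variance_fun_add hA (HasLaw.memLp_two_gaussianReal hZ), hZ.variance_eq,
    variance_id_gaussianReal]

/-- The tail condition at `R = 0`. It is what controls the means, which a bound on variances leaves
free. -/
theorem InTailClass.integral_sq_le {U : Ω → ℝ} {V : ℝ} (h : InTailClass ψ U P)
    (hV : variance U P ≤ V) : ∫ ω, U ω ^ 2 ∂P ≤ V * |ψ 0| := by
  have h0 := h.2 0 le_rfl
  simp only [zero_mul, abs_nonneg, Set.ofPred_true, Measure.restrict_univ] at h0
  calc _ ≤ variance U P * ψ 0 := h0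
    _ ≤ variance U P * |ψ 0| := mul_le_mul_of_nonneg_left (le_abs_self _) (variance_nonneg _ _)
    _ ≤ _ := by gcongr

/-- Replacing `σ` by the larger `√V` shrinks the tail event and makes the threshold the same for the
whole class. -/
theorem InTailClass.setIntegral_sq_le {U : Ω → ℝ} {V r : ℝ} (h : InTailClass ψ U P)
    (hV : variance U P ≤ V) (hr : 0 ≤ r) :
    ∫ ω in {ω | r * √V ≤ |U ω|}, U ω ^ 2 ∂P ≤ V * |ψ r| := by
  have hsub : {ω | r * √V ≤ |U ω|} ⊆ {ω | r * √(variance U P) ≤ |U ω|} := fun ω hω =>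
    le_trans (mul_le_mul_of_nonneg_left (Real.sqrt_le_sqrt hV) hr) hω
  calc _ ≤ ∫ ω in {ω | r * √(variance U P) ≤ |U ω|}, U ω ^ 2 ∂P :=
        setIntegral_mono_set h.1.integrable_sq.integrableOn
          (Eventually.of_forall fun _ => sq_nonneg _) hsub.eventuallyLE
    _ ≤ variance U P * ψ r := h.2 r hr
    _ ≤ variance U P * |ψ r| := mul_le_mul_of_nonneg_left (le_abs_self _) (variance_nonneg _ _)
    _ ≤ _ := by gcongr

namespace IsTailPair

theorem variance_X_le (h : IsTailPair ψ S T ZS ZT X Y τ K P) : variance X P ≤ |K| + τ := by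
  rw [h.eq_left, variance_add_gaussian h.memLp_left h.noise.law_left
    (h.noise.indep.comp measurable_fst measurable_fst)]
  linarith [h.variance_left, le_abs_self K]

theorem variance_Y_le (h : IsTailPair ψ S T ZS ZT X Y τ K P) : variance Y P ≤ |K| + τ := by
  rw [h.eq_right, variance_add_gaussian h.memLp_right h.noise.law_right
    (h.noise.indep.comp measurable_snd measurable_snd)]
  linarith [h.variance_right, le_abs_self K]

end IsTailPair

variable [IsProbabilityMeasure P]

/-- Independent centred noise keeps the mean and raises the variance; this passes the second moment
bound from `X` to `S`. -/
theorem integral_sq_le_integral_add_gaussian_sq {A Z : Ω → ℝ} (hA : MemLp A 2 P)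
    (hZ : HasLaw Z (gaussianReal 0 τ) P) (hind : IndepFun A Z P) :
    ∫ ω, A ω ^ 2 ∂P ≤ ∫ ω, (A ω + Z ω) ^ 2 ∂P := by
  have hZ2 := HasLaw.memLp_two_gaussianReal hZ
  have h1 := variance_eq_sub hA
  have h2 := variance_eq_sub (hA.add hZ2)
  have h3 : variance (A + Z) P = variance A P + τ := variance_add_gaussian hA hZ hind
  have h4 : ∫ ω, (A + Z) ω ∂P = ∫ ω, A ω ∂P := by
    simp only [Pi.add_apply]
    rw [integral_add (hA.integrable one_le_two) (hZ2.integrable one_le_two), hZ.integral_eq]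
    simp
  simp only [Pi.pow_apply, Pi.add_apply] at h1 h2 h4
  rw [h4] at h2
  linarith [τ.coe_nonneg]

theorem IsTailPair.isPerturbedPair (h : IsTailPair ψ S T ZS ZT X Y τ K P) :
    IsPerturbedPair S T ZS ZT X Y τ ((|K| + τ) * |ψ 0|) P where
  pos := h.pos
  memLp_left := h.memLp_left
  memLp_right := h.memLp_right
  integral_sq_left := by
    refine le_trans ?_ (h.tail_left.integral_sq_le h.variance_X_le)
    rw [h.eq_left]
    exact integral_sq_le_integral_add_gaussian_sq h.memLp_left h.noise.law_left
      (h.noise.indep.comp measurable_fst measurable_fst)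
  integral_sq_right := by
    refine le_trans ?_ (h.tail_right.integral_sq_le h.variance_Y_le)
    rw [h.eq_right]
    exact integral_sq_le_integral_add_gaussian_sq h.memLp_right h.noise.law_right
      (h.noise.indep.comp measurable_snd measurable_snd)
  noise := h.noise
  eq_left := h.eq_left
  eq_right := h.eq_right

end TailClass

/-! ### Uniform smallness over the class and the modulus `ν` -/

theorem exists_stdFisherInfo_le (ψ : ℝ → ℝ) {τ : ℝ≥0} (hτ : 0 < τ) (K : ℝ) :
    ∃ M : ℝ, 0 < M ∧ ∀ (Ω : Type*) [MeasurableSpace Ω] (P : Measure Ω) [IsProbabilityMeasure P]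
      (S T ZS ZT X Y : Ω → ℝ), IsTailPair ψ S T ZS ZT X Y τ K P → stdFisherInfo X P ≤ M := by
  have hτ' : (0 : ℝ) < τ := hτ
  obtain ⟨C, hC, hgrow⟩ := IsSmoothing.exists_abs_score_le hτ ((|K| + τ) * |ψ 0|)
  refine ⟨(|K| + τ) * (2 * C ^ 2 * (1 + (|K| + τ) * |ψ 0|)), by positivity, ?_⟩
  intro Ω _ P _ S T ZS ZT X Y h
  have hp := h.isPerturbedPair
  exact hp.isSmoothing_left.stdFisherInfo_le_of_growth h.variance_X_le
    (hgrow Ω P X S hp.isSmoothing_left hp.integral_sq_left)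
    (h.tail_left.integral_sq_le h.variance_X_le)

theorem exists_stdFisherInfo_le_of_Delta_lt {ψ : ℝ → ℝ} (hψ : Tendsto ψ atTop (𝓝 0)) {τ : ℝ≥0}
    (hτ : 0 < τ) (K : ℝ) {η : ℝ} (hη : 0 < η) :
    ∃ ε : ℝ, 0 < ε ∧ ∀ (Ω : Type*) [MeasurableSpace Ω] (P : Measure Ω) [IsProbabilityMeasure P]
      (S T ZS ZT X Y : Ω → ℝ), IsTailPair ψ S T ZS ZT X Y τ K P →
      ∀ β, 0 ≤ β → β ≤ 1 → Delta X Y β P < ε → β * (1 - β) * stdFisherInfo X P ≤ η := by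
  have hτ' : (0 : ℝ) < τ := hτ
  obtain ⟨M, hM, hbound⟩ := exists_stdFisherInfo_le ψ hτ K
  obtain ⟨C, hC, hgrow⟩ := IsSmoothing.exists_abs_score_le hτ ((|K| + τ) * |ψ 0|)
  set V := |K| + (τ : ℝ) with hVdef
  have hV : 0 < V := by positivity
  have hsV : 0 < √V := Real.sqrt_pos.2 hV
  -- The tail beyond `r √V` is to cost at most `η/2`, and `r ≥ 1/√V` makes this radius at least `1`.
  obtain ⟨r, hr, hψr⟩ : ∃ r, 1 / √V ≤ r ∧ V * ((6 * C + 1) ^ 2 * (V * |ψ r|)) ≤ η / 2 := by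
    have hlim : Tendsto (fun r => V * ((6 * C + 1) ^ 2 * (V * |ψ r|))) atTop (𝓝 0) := by
      have := ((hψ.abs.const_mul V).const_mul ((6 * C + 1) ^ 2)).const_mul V
      simpa using this
    exact ((eventually_ge_atTop (1 / √V)).and (hlim.eventually_le_const (half_pos hη))).exists
  have hr0 : 0 < r := lt_of_lt_of_le (by positivity) hr
  have hR : 1 ≤ r * √V := by rwa [div_le_iff₀ hsV] at hr
  -- If `β(1-β) ≤ η/M`, the uniform bound `M` is enough; otherwise `β` and `1-β` both exceed `η/M`,
  -- so both coefficients are at least `b₀`.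
  set b₀ := √(η / M) with hb₀def
  have hb₀ : 0 < b₀ := Real.sqrt_pos.2 (by positivity)
  set e := min 1 (√(η / (2 * V))) with hedef
  have he0 : 0 < e := lt_min one_pos (Real.sqrt_pos.2 (by positivity))
  have he1 : e ≤ 1 := min_le_left _ _
  have he2 : V * e ^ 2 ≤ η / 2 := by
    have h1 : e ^ 2 ≤ η / (2 * V) := by
      calc e ^ 2 ≤ √(η / (2 * V)) ^ 2 := by
            gcongr
            exact min_le_right _ _
        _ = _ := Real.sq_sqrt (by positivity)
    calc V * e ^ 2 ≤ V * (η / (2 * V)) := by gcongr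
      _ = η / 2 := by field_simp
  -- The tolerance `e * b₀ / 12` undoes the loss `12 / b₀` of the functional equation, leaving an
  -- affine error of `e`.
  obtain ⟨ε, hε, hdef⟩ := exists_abs_scoreDefect_le hτ (V * |ψ 0|)
    (2 * (r * √V) + r * √V / b₀) (δ := e * b₀ / 12) (by positivity)
  refine ⟨ε, hε, ?_⟩
  intro Ω _ P _ S T ZS ZT X Y h β hβ0 hβ1 hΔ
  have hββ : 0 ≤ β * (1 - β) := mul_nonneg hβ0 (by linarith)
  have hββ1 : β * (1 - β) ≤ 1 := by nlinarith
  rcases le_total (β * (1 - β)) (η / M) with hsmall | hlarge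
  · calc β * (1 - β) * stdFisherInfo X P ≤ β * (1 - β) * M := by
          gcongr
          exact hbound Ω P S T ZS ZT X Y h
      _ ≤ η / M * M := by gcongr
      _ = η := div_mul_cancel₀ _ hM.ne'
  have hp := h.isPerturbedPair
  have hX := hp.isSmoothing_left
  have ha : b₀ ≤ √β := Real.sqrt_le_sqrt (by nlinarith)
  have hb : b₀ ≤ √(1 - β) := Real.sqrt_le_sqrt (by nlinarith)
  obtain ⟨B, hB⟩ := exists_affine_approx_of_functional_eq hX.continuous_score hb₀ ha hb
    (Real.sqrt_le_one.2 hβ1) (by linarith) (hdef Ω P S T ZS ZT X Y hp β hβ0 hβ1 hΔ)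
  have hee : 12 * (e * b₀ / 12) / b₀ = e := by field_simp
  rw [hee] at hB
  have hmain := hX.stdFisherInfo_le_of_affine_approx h.variance_X_le hR he1
    (hgrow Ω P X S hX hp.integral_sq_left) hB
  have htail := h.tail_left.setIntegral_sq_le h.variance_X_le hr0.le
  have hfin : stdFisherInfo X P ≤ η := by
    refine hmain.trans ?_
    calc V * (e ^ 2 + (6 * C + 1) ^ 2 * ∫ ω in {ω | r * √V ≤ |X ω|}, X ω ^ 2 ∂P)
        ≤ V * (e ^ 2 + (6 * C + 1) ^ 2 * (V * |ψ r|)) := by gcongr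
      _ = V * e ^ 2 + V * ((6 * C + 1) ^ 2 * (V * |ψ r|)) := by ring
      _ ≤ η := by linarith
  calc β * (1 - β) * stdFisherInfo X P ≤ β * (1 - β) * η := by gcongr
    _ ≤ 1 * η := by gcongr
    _ = η := one_mul _

theorem proposition2p3 (ψ : ℝ → ℝ) (hψ : Tendsto ψ atTop (𝓝 0)) (τ : ℝ≥0) (hτ : 0 < τ) (K : ℝ) :
    ∃ ν : ℝ → ℝ, Tendsto ν (𝓝 0) (𝓝 0) ∧
      ∀ (Ω : Type*) [MeasurableSpace Ω] (P : Measure Ω) [IsProbabilityMeasure P]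
        (S T ZS ZT X Y : Ω → ℝ),
        MemLp S 2 P → MemLp T 2 P → variance S P ≤ K → variance T P ≤ K →
        IsGaussianPerturbation S T ZS ZT τ P →
        X = (fun ω => S ω + ZS ω) → Y = (fun ω => T ω + ZT ω) →
        InTailClass ψ X P → InTailClass ψ Y P →
        ∀ β : ℝ, 0 ≤ β → β ≤ 1 →
          HasSmoothDensity X P ∧ HasSmoothDensity Y P ∧ HasSmoothDensity (mix X Y β) P ∧
          Integrable (fun ω => score X P (X ω) ^ 2) P ∧
          Integrable (fun ω => scoreDefect X Y β P ω ^ 2) P ∧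
          β * (1 - β) * stdFisherInfo X P ≤ ν (Delta X Y β P) := by
  obtain ⟨M, hM, hbound⟩ := exists_stdFisherInfo_le ψ hτ K
  -- The value `0` is included so that the set is nonempty and its supremum nonnegative for every
  -- `t`.
  set vals : ℝ → Set ℝ := fun t => {v | v = 0 ∨ ∃ (Ω : Type _) (_ : MeasurableSpace Ω)
    (P : Measure Ω) (_ : IsProbabilityMeasure P) (S T ZS ZT X Y : Ω → ℝ) (β : ℝ),
    IsTailPair ψ S T ZS ZT X Y τ K P ∧ 0 ≤ β ∧ β ≤ 1 ∧ Delta X Y β P = t ∧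
      v = β * (1 - β) * stdFisherInfo X P} with hvals
  have hbdd : ∀ t, BddAbove (vals t) := fun t => by
    refine ⟨M, ?_⟩
    rintro v (rfl | ⟨Ω, _, P, _, S, T, ZS, ZT, X, Y, β, h, hβ0, hβ1, -, rfl⟩)
    · exact hM.le
    · have hββ : 0 ≤ β * (1 - β) := mul_nonneg hβ0 (by linarith)
      calc β * (1 - β) * stdFisherInfo X P ≤ β * (1 - β) * M := by
            gcongr
            exact hbound Ω P S T ZS ZT X Y h
        _ ≤ 1 * M := by
            gcongr
            nlinarith
        _ = M := one_mul _
  refine ⟨fun t => sSup (vals t), ?_, ?_⟩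
  -- The neighbourhood of `0` is not punctured, so this limit also contains `ν 0 = 0`.
  · rw [Metric.tendsto_nhds_nhds]
    intro η hη
    obtain ⟨ε, hε, hsmall⟩ := exists_stdFisherInfo_le_of_Delta_lt hψ hτ K (half_pos hη)
    refine ⟨ε, hε, fun t ht => ?_⟩
    rw [Real.dist_eq, sub_zero] at ht ⊢
    have h0 : 0 ≤ sSup (vals t) := le_csSup (hbdd t) (Or.inl rfl)
    rw [abs_of_nonneg h0]
    refine lt_of_le_of_lt (csSup_le ⟨0, Or.inl rfl⟩ ?_) (half_lt_self hη)
    rintro v (rfl | ⟨Ω, _, P, _, S, T, ZS, ZT, X, Y, β, h, hβ0, hβ1, hΔ, rfl⟩)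
    · exact (half_pos hη).le
    · exact hsmall Ω P S T ZS ZT X Y h β hβ0 hβ1
        (hΔ.trans_lt (lt_of_le_of_lt (le_abs_self t) ht))
  · intro Ω _ P _ S T ZS ZT X Y hS hT hSK hTK hN hX hY hXψ hYψ β hβ0 hβ1
    have h : IsTailPair ψ S T ZS ZT X Y τ K P := ⟨hτ, hS, hT, hSK, hTK, hN, hX, hY, hXψ, hYψ⟩
    have hp := h.isPerturbedPair
    exact ⟨hp.isSmoothing_left.hasSmoothDensity, hp.isSmoothing_right.hasSmoothDensity,
      (hp.isSmoothing_mix hβ0 hβ1).hasSmoothDensity,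
      hp.isSmoothing_left.memLp_score.integrable_sq, (hp.memLp_scoreDefect hβ0 hβ1).integrable_sq,
      le_csSup (hbdd _) (Or.inr ⟨Ω, _, P, inferInstance, S, T, ZS, ZT, X, Y, β, h, hβ0, hβ1, rfl,
        rfl⟩)⟩
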